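/- Let $\mathbb{F}_q$ be a finite field of odd characteristic, let $(V,\omega)$ be a symplectic vector space of dimension $2n$ over $\mathbb{F}_q$, and let $\psi:\mathbb{F}_q\to\mathbb{C}^{*}$ be a non-trivial additive character. Let $H=V\times\mathbb{F}_q$ be the Heisenberg group, with multiplication $(v,z)\cdot(v',z')=(v+v',\,z+z'+\tfrac12\omega(v,v'))$, and let $G=\mathrm{Sp}(V,\omega)$ act on $H$ by $g(v,z)=(gv,z)$. An enhanced Lagrangian is a pair $L^{\circ}=(L,\sigma_L)$, where $L\subset V$ is a Lagrangian subspace and $0\neq\sigma_L\in\Lambda^{n}L$. The group $G$ acts on enhanced Lagrangians by $gL^{\circ}=(gL,\Lambda^{n}(g|_{L})\sigma_L)$, and $\mathbb{F}_q^{*}$ acts by $aL^{\circ}=(L,a\sigma_L)$. For an enhanced Lagrangian $L^{\circ}$ let $$\mathcal{H}_{L^{\circ}}=\{f:H\to\mathbb{C}\;:\; f((l,z)\cdot h)=\psi(z)f(h)\ \text{ for all } l\in L,\ z\in\mathbb{F}_q,\ h\in H\},$$ on which $H$ acts by right translations; as a space of functions it depends on $L$ only, so that $\mathcal{H}_{aL^{\circ}}=\mathcal{H}_{L^{\circ}}$.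 Each $g\in G$ gives an isomorphism $g:\mathcal{H}_{L^{\circ}}\to\mathcal{H}_{gL^{\circ}}$, $(g\cdot f)(h)=f(g^{-1}h)$. Let $\chi_q:\mathbb{F}_q^{*}\to\{\pm1\}$ be the Legendre quadratic character. Theorem (Canonical intertwining operators). There exists a unique family of intertwining operators $F_{M^{\circ},L^{\circ}}\in\mathrm{Hom}_{H}(\mathcal{H}_{L^{\circ}},\mathcal{H}_{M^{\circ}})$, indexed by all pairs $(M^{\circ},L^{\circ})$ of enhanced Lagrangians, with the following properties: 1. (Normalization) $F_{L^{\circ},L^{\circ}}=\mathrm{Id}$ for every $L^{\circ}$. 2. (Invariance) $F_{gM^{\circ},gL^{\circ}}=g\circ F_{M^{\circ},L^{\circ}}\circ g^{-1}$ for every $g\in G$ and all $M^{\circ},L^{\circ}$. 3. (Convolution) $F_{N^{\circ},M^{\circ}}\circ F_{M^{\circ},L^{\circ}}=F_{N^{\circ},L^{\circ}}$ for all $N^{\circ},M^{\circ},L^{\circ}$. 4. (Sign rule) $F_{aM^{\circ},L^{\circ}}=\chi_q(a)\,F_{M^{\circ},L^{\circ}}$ and $F_{M^{\circ},aL^{\circ}}=\chi_q(a)\,F_{M^{\circ},L^{\circ}}$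 for every $a\in\mathbb{F}_q^{*}$ and all $M^{\circ},L^{\circ}$. -/

import Mathlib

noncomputable section

namespace FiniteHeisenberg

variable {F : Type*} [Field F] {V : Type*} [AddCommGroup V] [Module F V]

/-- The set underlying the Heisenberg group of `(V, ω)`, that is `V × F`. -/
@[ext]
structure Heis (ω : LinearMap.BilinForm F V) where
  /-- The component in `V`. -/
  vec : V
  /-- The component in the center `F`. -/
  ctr : F

namespace Heis

variable {ω : LinearMap.BilinForm F V}

/-- `(v, z) * (v', z') = (v + v', z + z' + ω(v, v') / 2)`. -/
instance : Mul (Heis ω) := ⟨fun a b => ⟨a.vec + b.vec, a.ctr + b.ctr + 2⁻¹ * ω a.vec b.vec⟩⟩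

instance : One (Heis ω) := ⟨⟨0, 0⟩⟩

/-- For an alternating form this is `(v, z)⁻¹ = (-v, -z)`. -/
instance : Inv (Heis ω) := ⟨fun a => ⟨-a.vec, -a.ctr + 2⁻¹ * ω a.vec a.vec⟩⟩

@[simp] theorem mul_vec (a b : Heis ω) : (a * b).vec = a.vec + b.vec := rfl

@[simp] theorem mul_ctr (a b : Heis ω) :
    (a * b).ctr = a.ctr + b.ctr + 2⁻¹ * ω a.vec b.vec := rfl

@[simp] theorem one_vec : (1 : Heis ω).vec = 0 := rfl

@[simp] theorem one_ctr : (1 : Heis ω).ctr = 0 := rfl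

@[simp] theorem inv_vec (a : Heis ω) : (a⁻¹).vec = -a.vec := rfl

@[simp] theorem inv_ctr (a : Heis ω) : (a⁻¹).ctr = -a.ctr + 2⁻¹ * ω a.vec a.vec := rfl

/-- The Heisenberg group. -/
instance : Group (Heis ω) :=
  Group.ofLeftAxioms
    (fun a b c => by
      ext
      · simp [add_assoc]
      · simp only [mul_ctr, mul_vec, map_add, LinearMap.add_apply]
        ring)
    (fun a => by ext <;> simp)
    (fun a => by ext <;> simp)

end Heis

variable (ω : LinearMap.BilinForm F V)

/-- The symplectic group `Sp(V, ω)`. -/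
def Sp : Subgroup (V ≃ₗ[F] V) where
  carrier := {g | ∀ x y, ω (g x) (g y) = ω x y}
  mul_mem' {g h} hg hh x y := by
    rw [LinearEquiv.mul_apply, LinearEquiv.mul_apply, hg, hh]
  one_mem' _ _ := rfl
  inv_mem' {g} hg x y := by
    have h := hg (g⁻¹ x) (g⁻¹ y)
    rw [← LinearEquiv.mul_apply, ← LinearEquiv.mul_apply, mul_inv_cancel] at h
    exact h.symm

/-- `Sp(V, ω)` acts on the Heisenberg group by automorphisms, trivially on the center. -/
def Sp.onHeis (g : Sp ω) : Heis ω ≃* Heis ω where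
  toFun a := ⟨g.1 a.vec, a.ctr⟩
  invFun a := ⟨g.1.symm a.vec, a.ctr⟩
  left_inv a := by ext <;> simp
  right_inv a := by ext <;> simp
  map_mul' a b := by
    ext
    · simp
    · simp [g.2 a.vec b.vec]

/-- Lagrangian subspaces: those that equal their own orthogonal complement. -/
def IsLagrangian (L : Submodule F V) : Prop := L.orthogonalBilin ω = L

theorem IsLagrangian.map {L : Submodule F V} (hL : IsLagrangian ω L) (g : Sp ω) :
    IsLagrangian ω (L.map (g.1 : V →ₗ[F] V)) := by
  ext x
  have key : (∀ y ∈ L, ω y (g.1.symm x) = 0) ↔ g.1.symm x ∈ L :=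
    SetLike.ext_iff.mp (show L.orthogonalBilin ω = L from hL) (g.1.symm x)
  have h1 : x ∈ L.map (g.1 : V →ₗ[F] V) ↔ g.1.symm x ∈ L := by
    constructor
    · rintro ⟨y, hy, rfl⟩
      simpa using hy
    · intro h
      exact ⟨_, h, by simp⟩
  rw [h1, ← key]
  constructor
  · intro h y hy
    have h2 : ω (g.1 y) x = 0 := h (g.1 y) ⟨y, hy, rfl⟩
    rw [← g.2 y (g.1.symm x), LinearEquiv.apply_symm_apply]
    exact h2
  · rintro h _ ⟨y, hy, rfl⟩
    have h2 := h y hy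
    rw [← g.2 y (g.1.symm x), LinearEquiv.apply_symm_apply] at h2
    exact h2

/-- An enhanced Lagrangian `(L, σ)` of a symplectic space of dimension `2n`: a Lagrangian subspace
`L` with a nonzero vector `σ` of the top exterior power `Λⁿ L`. -/
structure EnhancedLagrangian (n : ℕ) where
  /-- The Lagrangian subspace. -/
  L : Submodule F V
  isLagrangian : IsLagrangian ω L
  /-- The volume form. -/
  σ : ⋀[F]^n L
  σ_ne_zero : σ ≠ 0

namespace EnhancedLagrangian

variable {ω} {n : ℕ}

/-- `a • (L, σ) = (L, a • σ)` for `a ∈ Fˣ`. -/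
instance : SMul Fˣ (EnhancedLagrangian ω n) :=
  ⟨fun a P => ⟨P.L, P.isLagrangian, (a : F) • P.σ, smul_ne_zero a.ne_zero P.σ_ne_zero⟩⟩

/-- `g • (L, σ) = (g(L), Λⁿ(g|_L)(σ))` for `g ∈ Sp(V, ω)`. -/
instance : SMul (Sp ω) (EnhancedLagrangian ω n) :=
  ⟨fun g P =>
    { L := P.L.map (g.1 : V →ₗ[F] V)
      isLagrangian := P.isLagrangian.map ω g
      σ := exteriorPower.map n (g.1.submoduleMap P.L).toLinearMap P.σ
      σ_ne_zero := fun h => P.σ_ne_zero <|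
        exteriorPower.map_injective_field
          (f := (g.1.submoduleMap P.L).toLinearMap) (g.1.submoduleMap P.L).injective (h.trans (map_zero _).symm) }⟩

end EnhancedLagrangian

variable {ω} {n : ℕ} (ψ : AddChar F ℂ)

/-- The space of functions `f` on the Heisenberg group with `f((l, z) * h) = ψ(z) f(h)` for
all `l ∈ L`, `z ∈ F`; this is the representation induced from the character `(l, z) ↦ ψ(z)` of the
subgroup `L × F`. It depends on `P = (L, σ)` through `L` only, so the models of `P` and of `a • P`
are the same space of functions. -/
def Model (P : EnhancedLagrangian ω n) : Submodule ℂ (Heis ω → ℂ) where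
  carrier := {f | ∀ l : Heis ω, l.vec ∈ P.L → ∀ h, f (l * h) = ψ l.ctr * f h}
  add_mem' {f f'} hf hf' l hl h := by simp [hf l hl h, hf' l hl h, mul_add]
  zero_mem' l hl h := by simp
  smul_mem' c f hf l hl h := by
    simp only [Pi.smul_apply, smul_eq_mul, hf l hl h]
    ring

/-- The Heisenberg group acts on the model by right translations. -/
def modelRep (P : EnhancedLagrangian ω n) : Representation ℂ (Heis ω) (Model ψ P) where
  toFun k :=
    { toFun := fun f => ⟨fun h => f.1 (h * k), fun l hl h => by
        change f.1 (l * h * k) = ψ l.ctr * f.1 (h * k)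
        rw [mul_assoc]
        exact f.2 l hl (h * k)⟩
      map_add' := fun _ _ => rfl
      map_smul' := fun _ _ => rfl }
  map_one' := by
    ext f h
    simp
  map_mul' k k' := by
    ext f h
    simp [mul_assoc]

/-- The space of intertwining operators from the model of `P` to the model of `Q`. -/
abbrev Intertwiners (Q P : EnhancedLagrangian ω n) : Type _ :=
  Representation.IntertwiningMap (modelRep ψ P) (modelRep ψ Q)

/-- For `g ∈ Sp(V, ω)`, the isomorphism `f ↦ f ∘ g⁻¹` from the model of `P` to that of `g • P`. -/
def modelTransport (g : Sp ω) (P : EnhancedLagrangian ω n) :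
    Model ψ P ≃ₗ[ℂ] Model ψ (g • P) where
  toFun f := ⟨fun h => f.1 ((Sp.onHeis ω g).symm h), by
    rintro l ⟨y, hy, hyl⟩ h
    change f.1 ((Sp.onHeis ω g).symm (l * h)) = ψ l.ctr * f.1 ((Sp.onHeis ω g).symm h)
    rw [map_mul]
    refine f.2 ((Sp.onHeis ω g).symm l) ?_ _
    have : g.1.symm l.vec = y := by rw [← hyl]; exact g.1.symm_apply_apply y
    change g.1.symm l.vec ∈ P.L
    rw [this]
    exact hy⟩
  invFun f := ⟨fun h => f.1 (Sp.onHeis ω g h), by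
    intro l hl h
    change f.1 (Sp.onHeis ω g (l * h)) = ψ l.ctr * f.1 (Sp.onHeis ω g h)
    rw [map_mul]
    exact f.2 (Sp.onHeis ω g l) ⟨l.vec, hl, rfl⟩ _⟩
  left_inv f := by
    ext h
    simp
  right_inv f := by
    ext h
    simp
  map_add' _ _ := rfl
  map_smul' _ _ := rfl

end FiniteHeisenberg

end

open FiniteHeisenberg

/-! Write `A_{Q,P}` for the averaging operator from the model of `P` to that of `Q`. Existence: when
`X` is transversal to `N` and `M`, put `F_{N,M} = q⁻ⁿ χ(⟨x,N⟩) χ(⟨x,M⟩) A_{N,X} A_{X,M}`, where `x`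
is a basis of `X` and `⟨x,N⟩` is its determinant pairing with the volume element of `N`. The sign
rule is visible, and invariance follows by transporting `X` along with `N` and `M`. Since `A_{X,M}
A_{M,X} = qⁿ`, normalization and convolution hold whenever one `X` serves all the Lagrangians
involved. In odd characteristic any three Lagrangians have a common transversal
(`exists_isotropic_disjoint`).

The crux is independence of `X` (`intertwinerVia_eq`). An intertwiner is determined by one value
(`intertwiner_ext`), and for `A_{N,X} A_{X,M}` this value is the Gauss sum of the form `S = (ω(e_i,
f_j))`, with `e`, `f` the bases of `M`, `N` dual to `x`. Changing `X` replaces `S`, up to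
congruence, by `S * C` with `C` fixing `ker S`. This multiplies the Gauss sum by `χ(det C)`
(`quadGauss_mul`), which is exactly the change in the two pairing signs. The form `S` may be
degenerate, so `N` and `M` need not be transversal.

Uniqueness: two systems differ by scalars `c(N,M)` forming an `Sp`-invariant cocycle insensitive to
the volume elements. For transversal `N`, `M`, two symplectic maps carry `(N,M)` to pairs among `M`,
`N` and a third Lagrangian so that the cocycle identity reads `c² = c` (`cocycle_eq_one`). -/

namespace FiniteHeisenberg

open Matrix

/-! ### Gauss sums of possibly degenerate quadratic forms. -/

section GaussSums

set_option linter.unusedSectionVars false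

variable {F : Type*} [Field F] [Fintype F] [DecidableEq F]

/-- The Legendre character with complex values. -/
def legendre (a : F) : ℂ := ((quadraticChar F a : ℤ) : ℂ)

@[simp] theorem legendre_mul (a b : F) : legendre (a * b) = legendre a * legendre b := by
  rw [legendre, map_mul, Int.cast_mul]; rfl

@[simp] theorem legendre_one : legendre (1 : F) = 1 := by
  rw [legendre, map_one, Int.cast_one]

theorem legendre_mul_self {a : F} (ha : a ≠ 0) : legendre a * legendre a = 1 := by
  rw [legendre, ← Int.cast_mul, ← sq, quadraticChar_sq_one ha, Int.cast_one]

theorem legendre_prod {ι : Type*} (s : Finset ι) (d : ι → F) :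
    legendre (∏ i ∈ s, d i) = ∏ i ∈ s, legendre (d i) := by
  rw [legendre, map_prod, Int.cast_prod]; rfl

theorem legendre_ne_zero {a : F} (ha : a ≠ 0) : legendre a ≠ 0 :=
  left_ne_zero_of_mul_eq_one (legendre_mul_self ha)

variable (ψ : AddChar F ℂ)

/-- An element `u` has `χ(u) + 1` square roots, and the constant `1` contributes nothing because a
non-trivial additive character sums to zero. -/
theorem sum_addChar_mul_sq (hF : ringChar F ≠ 2) {ψ : AddChar F ℂ} (hψ : ψ ≠ 1) {a : F}
    (ha : a ≠ 0) :
    ∑ t, ψ (a * t ^ 2) =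
      gaussSum ((quadraticChar F).ringHomComp (Int.castRingHom ℂ)) (ψ.mulShift a) := by
  have hprim : ψ.mulShift a ≠ 1 := AddChar.IsPrimitive.of_ne_one hψ ha
  have h0 : ∑ u, ψ (a * u) = 0 := by
    simpa using AddChar.sum_eq_zero_of_ne_one hprim
  have h1 : ∑ t, ψ (a * t ^ 2) =
      ∑ u : F, ∑ t ∈ Finset.univ.filter (fun t : F => t ^ 2 = u), ψ (a * u) := by
    rw [← Finset.sum_fiberwise (s := Finset.univ) (g := fun t : F => t ^ 2)]
    refine Finset.sum_congr rfl fun u _ => Finset.sum_congr rfl fun t ht => ?_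
    rw [(Finset.mem_filter.mp ht).2]
  have h2 (u : F) : ((Finset.univ.filter (fun t : F => t ^ 2 = u)).card : ℂ) =
      ((quadraticChar F u : ℤ) : ℂ) + 1 := by
    have := quadraticChar_card_sqrts hF u
    have h3 : {x : F | x ^ 2 = u}.toFinset = Finset.univ.filter (fun t : F => t ^ 2 = u) := by
      ext; simp
    rw [h3] at this
    exact_mod_cast this
  rw [h1, gaussSum]
  simp only [Finset.sum_const, nsmul_eq_mul, h2, add_mul, one_mul, Finset.sum_add_distrib, h0,
    add_zero]
  rfl

theorem sum_addChar_mul_sq_eq_legendre (hF : ringChar F ≠ 2) {ψ : AddChar F ℂ} (hψ : ψ ≠ 1)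
    {a b : F} (ha : a ≠ 0) (hb : b ≠ 0) :
    ∑ t, ψ (b * a * t ^ 2) = legendre a * ∑ t, ψ (b * t ^ 2) := by
  rw [sum_addChar_mul_sq hF hψ (mul_ne_zero hb ha), sum_addChar_mul_sq hF hψ hb,
    ← AddChar.mulShift_mulShift]
  have h := gaussSum_mulShift ((quadraticChar F).ringHomComp (Int.castRingHom ℂ))
    (ψ.mulShift b) (Units.mk0 a ha)
  rw [← h, ← mul_assoc]
  have : legendre a * ((quadraticChar F).ringHomComp (Int.castRingHom ℂ)) (Units.mk0 a ha) = 1 :=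
    legendre_mul_self ha
  rw [this, one_mul]
  rfl

theorem sum_addChar_mul_sq_ne_zero (hF : ringChar F ≠ 2) {ψ : AddChar F ℂ} (hψ : ψ ≠ 1) {a : F}
    (ha : a ≠ 0) : ∑ t, ψ (a * t ^ 2) ≠ 0 := by
  rw [sum_addChar_mul_sq hF hψ ha]
  refine gaussSum_ne_zero_of_nontrivial (by simp [Fintype.card_ne_zero]) ?_ ?_
  · intro h
    obtain ⟨u, hu⟩ := quadraticChar_exists_neg_one' hF
    have := congrArg (fun c : MulChar F ℂ => c u) h
    norm_num [MulChar.ringHomComp_apply, hu] at this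
  · exact AddChar.IsPrimitive.of_ne_one (AddChar.IsPrimitive.of_ne_one hψ ha)

variable {ι : Type*} [Fintype ι] [DecidableEq ι]

/-- The Gauss sum of the quadratic form `t ↦ tᵀ S t / 2`. -/
def quadGauss (S : Matrix ι ι F) : ℂ := ∑ t : ι → F, ψ (2⁻¹ * (t ⬝ᵥ S *ᵥ t))

theorem quadGauss_zero : quadGauss ψ (0 : Matrix ι ι F) = (Fintype.card F : ℂ) ^ Fintype.card ι := by
  simp [quadGauss]

theorem quadGauss_congruence (S : Matrix ι ι F) {P : Matrix ι ι F} (hP : IsUnit P.det) :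
    quadGauss ψ (Pᵀ * S * P) = quadGauss ψ S := by
  refine Fintype.sum_bijective (P *ᵥ ·) ?_ _ _ fun t => ?_
  · have hP' := (Matrix.isUnit_iff_isUnit_det P).mpr hP
    exact ⟨Matrix.mulVec_injective_iff_isUnit.mpr hP', Matrix.mulVec_surjective_iff_isUnit.mpr hP'⟩
  · rw [← Matrix.mulVec_mulVec, ← Matrix.mulVec_mulVec, Matrix.dotProduct_mulVec,
      Matrix.vecMul_transpose]

theorem quadGauss_diagonal (d : ι → F) :
    quadGauss ψ (diagonal d) = ∏ i, ∑ t, ψ (2⁻¹ * d i * t ^ 2) := by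
  rw [Fintype.prod_sum, quadGauss]
  refine Finset.sum_congr rfl fun t _ => ?_
  have hsum (s : Finset ι) (f : ι → F) : ψ (∑ i ∈ s, f i) = ∏ i ∈ s, ψ (f i) := by
    have h := map_prod ψ.toMonoidHom (fun i => Multiplicative.ofAdd (f i)) s
    simpa only [AddChar.toMonoidHom_apply, toAdd_prod, toAdd_ofAdd] using h
  rw [← hsum, dotProduct, Finset.mul_sum]
  congr 1
  refine Finset.sum_congr rfl fun i _ => ?_
  rw [mulVec_diagonal]
  ring

theorem exists_diagonal_of_isSymm (hF : ringChar F ≠ 2) {S : Matrix ι ι F} (hS : S.IsSymm) :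
    ∃ (P : Matrix ι ι F) (d : ι → F), IsUnit P.det ∧ Pᵀ * S * P = diagonal d := by
  have : Invertible (2 : F) := invertibleOfNonzero (Ring.two_ne_zero hF)
  have hsymm : (Matrix.toBilin' S).IsSymm := by
    rw [LinearMap.BilinForm.isSymm_def]
    intro x y
    rw [Matrix.toBilin'_apply', Matrix.toBilin'_apply', Matrix.dotProduct_mulVec,
      ← Matrix.mulVec_transpose, hS.eq, dotProduct_comm]
  obtain ⟨v, hv⟩ := LinearMap.BilinForm.exists_orthogonal_basis
    (LinearMap.BilinForm.isSymm_iff.mp hsymm)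
  let e : Fin (Module.finrank F (ι → F)) ≃ ι := Fintype.equivOfCardEq (by simp)
  let w := v.reindex e
  refine ⟨(Pi.basisFun F ι).toMatrix w, fun i => Matrix.toBilin' S (w i) (w i), ?_, ?_⟩
  · rw [← Module.Basis.det_apply]
    exact (Pi.basisFun F ι).isUnit_det w
  · ext i j
    have h : ((((Pi.basisFun F ι).toMatrix w)ᵀ * S * ((Pi.basisFun F ι).toMatrix w)) i j) =
        Matrix.toBilin' S (w i) (w j) := by
      rw [Matrix.toBilin'_apply', Matrix.mul_assoc, Matrix.mul_apply']
      rfl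
    rw [h]
    by_cases hij : i = j
    · subst hij; simp
    · rw [diagonal_apply_ne _ hij]
      have := hv (fun h => hij (e.symm.injective h) : e.symm i ≠ e.symm j)
      simpa [w] using this

/-- After diagonalization each variable contributes `χ(d i)` times a fixed one-variable sum; the
base change enters through `(det P)²`, which `χ` does not see. -/
theorem quadGauss_of_det_ne_zero (hF : ringChar F ≠ 2) {ψ : AddChar F ℂ} (hψ : ψ ≠ 1)
    {S : Matrix ι ι F} (hS : S.IsSymm) (hdet : S.det ≠ 0) :
    quadGauss ψ S = legendre S.det * (∑ t, ψ (2⁻¹ * t ^ 2)) ^ Fintype.card ι := by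
  obtain ⟨P, d, hP, hd⟩ := exists_diagonal_of_isSymm hF hS
  have hdet' : P.det * P.det * S.det = ∏ i, d i := by
    rw [← det_diagonal, ← hd, det_mul, det_mul, det_transpose]
    ring
  have hPd : P.det ≠ 0 := hP.ne_zero
  have hd0 : ∀ i, d i ≠ 0 := by
    have : ∏ i, d i ≠ 0 := hdet' ▸ mul_ne_zero (mul_ne_zero hPd hPd) hdet
    exact fun i => (Finset.prod_ne_zero_iff.mp this) i (Finset.mem_univ i)
  have h2 : (2 : F)⁻¹ ≠ 0 := inv_ne_zero (Ring.two_ne_zero hF)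
  rw [← quadGauss_congruence ψ S hP, hd, quadGauss_diagonal,
    Finset.prod_congr rfl fun i _ => sum_addChar_mul_sq_eq_legendre hF hψ (hd0 i) h2,
    Finset.prod_mul_distrib, ← legendre_prod, ← hdet', legendre_mul, legendre_mul,
    legendre_mul_self hPd]
  simp

/-- Adjoining a complementary diagonal form to a form supported off an idempotent diagonal. -/
theorem quadGauss_mul_quadGauss {S E : Matrix ι ι F} (hE : Eᵀ = E) (hEE : E * E = E)
    (hES : E * S = 0) (hSE : S * E = 0) :
    quadGauss ψ S * quadGauss ψ E =
      (Fintype.card F : ℂ) ^ Fintype.card ι * quadGauss ψ (S + E) := by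
  -- `swap` exchanges the `E`-components of `t` and `s`. Afterwards the first vector carries both
  -- forms, and the second is free and contributes only a power of `q`.
  let swap : (ι → F) × (ι → F) → (ι → F) × (ι → F) := fun p =>
    (p.1 - E *ᵥ p.1 + E *ᵥ p.2, p.2 - E *ᵥ p.2 + E *ᵥ p.1)
  have hswap : Function.Involutive swap := by
    rintro ⟨t, s⟩
    ext1 <;>
    simp only [swap, mulVec_add, mulVec_sub, mulVec_mulVec, hEE] <;> abel
  have hdot (x y : ι → F) : (E *ᵥ x) ⬝ᵥ y = x ⬝ᵥ E *ᵥ y := by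
    rw [dotProduct_mulVec, ← mulVec_transpose, hE]
  have hquad (t s : ι → F) :
      (swap (t, s)).1 ⬝ᵥ S *ᵥ (swap (t, s)).1 + (swap (t, s)).2 ⬝ᵥ E *ᵥ (swap (t, s)).2 =
        t ⬝ᵥ (S + E) *ᵥ t := by
    simp only [swap, mulVec_add, mulVec_sub, mulVec_mulVec, hEE, hSE, zero_mulVec, sub_zero,
      add_zero, sub_self, zero_add, add_dotProduct, sub_dotProduct, hdot, hES, dotProduct_zero,
      add_mulVec, dotProduct_add]
  calc quadGauss ψ S * quadGauss ψ E
      = ∑ p : (ι → F) × (ι → F), ψ (2⁻¹ * (p.1 ⬝ᵥ S *ᵥ p.1 + p.2 ⬝ᵥ E *ᵥ p.2)) := by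
        rw [quadGauss, quadGauss, Finset.sum_mul_sum, Fintype.sum_prod_type]
        simp only [mul_add, AddChar.map_add_eq_mul]
    _ = ∑ p : (ι → F) × (ι → F), ψ (2⁻¹ * (p.1 ⬝ᵥ (S + E) *ᵥ p.1)) := by
        refine (Fintype.sum_bijective swap hswap.bijective _ _ fun p => ?_).symm
        rw [← hquad p.1 p.2]
    _ = _ := by
        rw [Fintype.sum_prod_type_right]
        simp [quadGauss]

theorem quadGauss_diagonal_ne_zero (hF : ringChar F ≠ 2) {ψ : AddChar F ℂ} (hψ : ψ ≠ 1)
    (d : ι → F) : quadGauss ψ (diagonal d) ≠ 0 := by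
  rw [quadGauss_diagonal]
  refine Finset.prod_ne_zero_iff.mpr fun i _ => ?_
  by_cases hi : d i = 0
  · simp [hi]
  · exact sum_addChar_mul_sq_ne_zero hF hψ (mul_ne_zero (inv_ne_zero (Ring.two_ne_zero hF)) hi)

/-- Adding the projection `E` onto the kernel of `D = diagonal d` makes both `D` and `D * C`
nondegenerate and multiplies both Gauss sums by the same nonzero factor, up to a power of `q`. The
nondegenerate formula then compares determinants. -/
theorem quadGauss_diagonal_mul (hF : ringChar F ≠ 2) {ψ : AddChar F ℂ} (hψ : ψ ≠ 1)
    {d : ι → F} {C : Matrix ι ι F} (hdC : (diagonal d * C).IsSymm) (hC : C.det ≠ 0)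
    (hker : ∀ t, diagonal d *ᵥ t = 0 → C *ᵥ t = t) :
    quadGauss ψ (diagonal d * C) = legendre C.det * quadGauss ψ (diagonal d) := by
  set D := diagonal d with hD
  set E : Matrix ι ι F := diagonal fun i => if d i = 0 then 1 else 0 with hE
  have hET : Eᵀ = E := diagonal_transpose _
  have hDT : Dᵀ = D := diagonal_transpose _
  have hEE : E * E = E := by
    rw [hE, diagonal_mul_diagonal]; congr 1; ext i; split_ifs <;> simp
  have hDE : D * E = 0 := by
    rw [hD, hE, diagonal_mul_diagonal, ← diagonal_zero]; congr 1; ext i; split_ifs <;> simp [*]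
  have hED : E * D = 0 := by
    rw [hD, hE, diagonal_mul_diagonal, ← diagonal_zero]; congr 1; ext i; split_ifs <;> simp [*]
  have hCE : C * E = E := by
    refine Matrix.ext_of_mulVec_single fun i => ?_
    rw [← mulVec_mulVec]
    refine hker _ ?_
    rw [mulVec_mulVec, hDE, zero_mulVec]
  have hDCE : D * C * E = 0 := by rw [Matrix.mul_assoc, hCE, hDE]
  have hEDC : E * (D * C) = 0 := by rw [← Matrix.mul_assoc, hED, Matrix.zero_mul]
  have hdetDE : (D + E).det ≠ 0 := by
    rw [hD, hE, diagonal_add, det_diagonal]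
    refine Finset.prod_ne_zero_iff.mpr fun i _ => ?_
    split_ifs with h <;> simp [h]
  -- `(D + E) * C` differs from the wanted matrix by `E * (1 - C)`; since `C * E = E`, this
  -- correction can be absorbed in a right factor, of determinant `1` because `(1 - C) * E = 0`.
  have hfac : D * C + E = (D + E) * C * (1 + E * (1 - C)) := by
    have h1 : C * (E * (1 - C)) = E * (1 - C) := by rw [← Matrix.mul_assoc, hCE]
    have h2 : (D + E) * (E * (1 - C)) = E * (1 - C) := by
      rw [← Matrix.mul_assoc, Matrix.add_mul, hDE, hEE, zero_add]
    rw [Matrix.mul_add, Matrix.mul_assoc _ C (E * (1 - C)), h1, h2, Matrix.mul_one, Matrix.add_mul,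
      Matrix.mul_sub, Matrix.mul_one]
    abel
  have hunip : (1 + E * (1 - C)).det = 1 := by
    rw [det_one_add_mul_comm, Matrix.sub_mul, hCE, Matrix.one_mul, sub_self, add_zero, det_one]
  have hdet : (D * C + E).det = (D + E).det * C.det := by
    rw [hfac, det_mul, det_mul, hunip, mul_one]
  have hsymmDE : (D + E).IsSymm := by
    rw [Matrix.IsSymm, transpose_add, hDT, hET]
  have hsymmDCE : (D * C + E).IsSymm := by
    rw [Matrix.IsSymm, transpose_add, hdC.eq, hET]
  have e1 := quadGauss_mul_quadGauss ψ hET hEE hED hDE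
  have e2 := quadGauss_mul_quadGauss ψ hET hEE hEDC hDCE
  rw [quadGauss_of_det_ne_zero hF hψ hsymmDE hdetDE] at e1
  rw [quadGauss_of_det_ne_zero hF hψ hsymmDCE (hdet ▸ mul_ne_zero hdetDE hC), hdet,
    legendre_mul] at e2
  have hne : quadGauss ψ E ≠ 0 := quadGauss_diagonal_ne_zero hF hψ _
  refine mul_right_cancel₀ hne ?_
  rw [e2, mul_assoc (legendre C.det) (quadGauss ψ D), e1]
  ring

/-- Right multiplication of a symmetric matrix `S` by a matrix `C` that fixes the kernel of `S`
multiplies the Gauss sum by the Legendre symbol of `det C`. -/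
theorem quadGauss_mul (hF : ringChar F ≠ 2) {ψ : AddChar F ℂ} (hψ : ψ ≠ 1)
    {S C : Matrix ι ι F} (hS : S.IsSymm) (hSC : (S * C).IsSymm) (hC : C.det ≠ 0)
    (hker : ∀ t, S *ᵥ t = 0 → C *ᵥ t = t) :
    quadGauss ψ (S * C) = legendre C.det * quadGauss ψ S := by
  obtain ⟨P, d, hP, hd⟩ := exists_diagonal_of_isSymm hF hS
  have hPP : P * P⁻¹ = 1 := mul_nonsing_inv P hP
  have hPP' : P⁻¹ * P = 1 := nonsing_inv_mul P hP
  have hPT : IsUnit Pᵀ.det := by rwa [det_transpose]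
  -- Diagonalizing `S` by congruence conjugates `C`, which preserves its determinant and the
  -- condition on the kernel.
  have hprod : Pᵀ * (S * C) * P = diagonal d * (P⁻¹ * C * P) := by
    rw [← hd]
    calc Pᵀ * (S * C) * P = Pᵀ * S * 1 * C * P := by simp only [Matrix.mul_assoc, Matrix.one_mul]
      _ = _ := by rw [← hPP]; simp only [Matrix.mul_assoc]
  have hdet : (P⁻¹ * C * P).det = C.det := by
    rw [Matrix.mul_assoc, det_mul_comm, Matrix.mul_assoc, hPP, Matrix.mul_one]
  rw [← quadGauss_congruence ψ S hP, ← quadGauss_congruence ψ (S * C) hP, hprod, hd,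
    quadGauss_diagonal_mul hF hψ, hdet]
  · rw [← hprod, Matrix.IsSymm, transpose_mul, transpose_mul, transpose_transpose, hSC.eq,
      ← Matrix.mul_assoc]
  · rwa [hdet]
  · intro t ht
    have h1 : S *ᵥ (P *ᵥ t) = 0 := by
      rw [← hd, Matrix.mul_assoc, ← mulVec_mulVec, ← mulVec_mulVec] at ht
      exact (Matrix.mulVec_injective_iff_isUnit.mpr
        ((Matrix.isUnit_iff_isUnit_det _).mpr hPT)) (by simpa using ht)
    have h2 := hker _ h1
    rw [← mulVec_mulVec, ← mulVec_mulVec, h2, mulVec_mulVec, hPP', one_mulVec]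

end GaussSums

end FiniteHeisenberg

namespace FiniteHeisenberg

open Matrix Module

/-! ### Transversal Lagrangians, dual bases and the determinant pairing. -/

section Geometry

variable {F : Type*} [Field F] {V : Type*} [AddCommGroup V] [Module F V]
  {ω : LinearMap.BilinForm F V} {n : ℕ}

theorem IsLagrangian.mem_iff {L : Submodule F V} (hL : IsLagrangian ω L) {x : V} :
    x ∈ L ↔ ∀ y ∈ L, ω y x = 0 :=
  (SetLike.ext_iff.mp (show L.orthogonalBilin ω = L from hL) x).symm

theorem IsLagrangian.apply_eq_zero {L : Submodule F V} (hL : IsLagrangian ω L) {x y : V}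
    (hx : x ∈ L) (hy : y ∈ L) : ω x y = 0 :=
  hL.mem_iff.mp hy x hx

theorem IsLagrangian.finrank_eq [FiniteDimensional F V] (hω' : ω.Nondegenerate)
    (hV : finrank F V = 2 * n) {L : Submodule F V} (hL : IsLagrangian ω L) :
    finrank F L = n := by
  have h := LinearMap.BilinForm.finrank_orthogonal hω' L
  have h' : ω.orthogonal L = L := hL
  have := L.finrank_le
  rw [h'] at h
  omega

theorem isLagrangian_of_finrank [FiniteDimensional F V] (hω' : ω.Nondegenerate)
    (hV : finrank F V = 2 * n) {L : Submodule F V} (hL : ∀ x ∈ L, ∀ y ∈ L, ω x y = 0)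
    (hn : finrank F L = n) : IsLagrangian ω L := by
  have h := LinearMap.BilinForm.finrank_orthogonal hω' L
  refine (Submodule.eq_of_le_of_finrank_eq (S₁ := L) (S₂ := ω.orthogonal L) ?_ ?_).symm
  · intro y hy x hx
    exact hL x hx y hy
  · omega

theorem exists_notMem_notMem {E : Type*} [AddCommGroup E] [Module F E] {W₁ W₂ : Submodule F E}
    (h₁ : W₁ ≠ ⊤) (h₂ : W₂ ≠ ⊤) : ∃ u, u ∉ W₁ ∧ u ∉ W₂ := by
  obtain ⟨u, hu⟩ := SetLike.exists_not_mem_of_ne_top W₁ h₁ rfl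
  obtain ⟨v, hv⟩ := SetLike.exists_not_mem_of_ne_top W₂ h₂ rfl
  by_cases hu2 : u ∈ W₂
  · by_cases hv1 : v ∈ W₁
    · exact ⟨u + v, fun h => hu ((W₁.add_mem_iff_left hv1).mp h),
        fun h => hv ((W₂.add_mem_iff_right hu2).mp h)⟩
    · exact ⟨v, hv1, hv⟩
  · exact ⟨u, hu, hu2⟩

/-- A vector space in odd characteristic is not the union of three proper subspaces. -/
theorem exists_notMem_three (h2 : (2 : F) ≠ 0) {E : Type*} [AddCommGroup E] [Module F E]
    {W : Fin 3 → Submodule F E} (hW : ∀ i, W i ≠ ⊤) : ∃ u, ∀ i, u ∉ W i := by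
  obtain ⟨u, hu0, hu1⟩ := exists_notMem_notMem (hW 0) (hW 1)
  by_cases hu2 : u ∈ W 2
  swap
  · exact ⟨u, fun i => by fin_cases i <;> assumption⟩
  -- The line `v + t • u` misses `W 2` because `u ∈ W 2` and `v ∉ W 2`. Each of `W 0`, `W 1`
  -- contains at most one of its three distinct points `t = 0, 1, 2`, so one of them survives.
  obtain ⟨v, hv⟩ := SetLike.exists_not_mem_of_ne_top (W 2) (hW 2) rfl
  have key (i : Fin 3) (hi : u ∉ W i) {s t : F} (hst : s ≠ t) (hs : v + s • u ∈ W i) :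
      v + t • u ∉ W i := fun ht => hi <| by
    have h := (W i).sub_mem hs ht
    rw [add_sub_add_left_eq_sub, ← sub_smul] at h
    exact ((W i).smul_mem_iff (sub_ne_zero.mpr hst)).mp h
  have hlast (t : F) : v + t • u ∉ W 2 := fun h =>
    hv (((W 2).add_mem_iff_left ((W 2).smul_mem t hu2)).mp h)
  have h01 : (0 : F) ≠ 1 := zero_ne_one
  have h02 : (0 : F) ≠ 2 := h2.symm
  have h12 : (1 : F) ≠ 2 := fun h => one_ne_zero (α := F) (by linear_combination -h)
  have : ∃ t : F, v + t • u ∉ W 0 ∧ v + t • u ∉ W 1 := by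
    by_contra! hcon
    by_cases a0 : v + (0 : F) • u ∈ W 0
    · have b1 := hcon 1 (key 0 hu0 h01 a0)
      have b2 := hcon 2 (key 0 hu0 h02 a0)
      exact key 1 hu1 h12 b1 b2
    · have b0 := hcon 0 a0
      have a1 : v + (1 : F) • u ∈ W 0 := by
        by_contra a1; exact key 1 hu1 h01 b0 (hcon 1 a1)
      have a2 : v + (2 : F) • u ∈ W 0 := by
        by_contra a2; exact key 1 hu1 h02 b0 (hcon 2 a2)
      exact key 0 hu0 h12 a1 a2
  obtain ⟨t, ht0, ht1⟩ := this
  exact ⟨v + t • u, fun i => by fin_cases i; exacts [ht0, ht1, hlast t]⟩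

/-- Grow `H` one vector at a time. A vector `u` of `Hᗮ` outside every `H + (N i ∩ Hᗮ)` keeps the
span isotropic and disjoint from each `N i`. -/
theorem exists_isotropic_disjoint [FiniteDimensional F V] (h2 : (2 : F) ≠ 0) (hω : ω.IsAlt)
    (hω' : ω.Nondegenerate) (hV : finrank F V = 2 * n) {N : Fin 3 → Submodule F V}
    (hN : ∀ i, IsLagrangian ω (N i)) (k : ℕ) (hk : k ≤ n) :
    ∃ H : Submodule F V, (∀ x ∈ H, ∀ y ∈ H, ω x y = 0) ∧ finrank F H = k ∧
      ∀ i, Disjoint H (N i) := by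
  induction k with
  | zero =>
    refine ⟨⊥, fun x hx y _ => ?_, finrank_bot F V, fun i => disjoint_bot_left⟩
    rw [(Submodule.mem_bot F).mp hx]; simp
  | succ k ih =>
    obtain ⟨H, hH, hHk, hHN⟩ := ih (by omega)
    have hHorth : H ≤ ω.orthogonal H := fun y hy x hx => hH x hx y hy
    have hdimH := LinearMap.BilinForm.finrank_orthogonal hω' H
    let W : Fin 3 → Submodule F (ω.orthogonal H) := fun i =>
      (H ⊔ (N i ⊓ ω.orthogonal H)).comap (ω.orthogonal H).subtype
    -- Since `N i ∩ Hᗮ ⊆ (N i + H)ᗮ` has dimension at most `n - k`, the sum has dimension at most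
    -- `n`, less than `2n - k = dim Hᗮ`.
    have hW : ∀ i, W i ≠ ⊤ := by
      intro i htop
      have hle : ω.orthogonal H ≤ H ⊔ (N i ⊓ ω.orthogonal H) := by
        rwa [Submodule.comap_subtype_eq_top] at htop
      have h1 := Submodule.finrank_mono hle
      have h3 := Submodule.finrank_add_le_finrank_add_finrank H (N i ⊓ ω.orthogonal H)
      have h4 : N i ⊓ ω.orthogonal H ≤ ω.orthogonal (N i ⊔ H) := by
        rintro y ⟨hy1, hy2⟩ x hx
        obtain ⟨a, ha, b, hb, rfl⟩ := Submodule.mem_sup.mp hx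
        change ω (a + b) y = 0
        rw [map_add, LinearMap.add_apply, (hN i).apply_eq_zero ha hy1, hy2 b hb, add_zero]
      have h5 := Submodule.finrank_mono h4
      rw [LinearMap.BilinForm.finrank_orthogonal hω'] at h5
      have h6 := Submodule.finrank_sup_add_finrank_inf_eq (N i) H
      rw [(hHN i).symm.eq_bot, finrank_bot, (hN i).finrank_eq hω' hV] at h6
      omega
    obtain ⟨⟨u, hu⟩, huW⟩ := exists_notMem_three h2 hW
    have huH : u ∉ H := fun h => huW 0 (Submodule.mem_sup_left h)
    refine ⟨H ⊔ F ∙ u, ?_, ?_, fun i => ?_⟩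
    · intro x hx y hy
      obtain ⟨a, ha, _, hb, rfl⟩ := Submodule.mem_sup.mp hx
      obtain ⟨c, hc, _, hd, rfl⟩ := Submodule.mem_sup.mp hy
      obtain ⟨s, rfl⟩ := Submodule.mem_span_singleton.mp hb
      obtain ⟨t, rfl⟩ := Submodule.mem_span_singleton.mp hd
      have e1 : ω a u = 0 := hu a ha
      have e2 : ω u c = 0 := by rw [← hω.neg_eq, show ω c u = 0 from hu c hc, neg_zero]
      simp [hH a ha c hc, e1, e2, hω.self_eq_zero u]
    · have h6 := Submodule.finrank_sup_add_finrank_inf_eq H (F ∙ u)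
      have hd : Disjoint H (F ∙ u) := by
        rw [Submodule.disjoint_span_singleton' (by rintro rfl; exact huH H.zero_mem)]
        exact huH
      rw [hd.eq_bot, finrank_bot,
        finrank_span_singleton (by rintro rfl; exact huH H.zero_mem)] at h6
      omega
    · rw [Submodule.disjoint_def]
      intro x hx hxN
      obtain ⟨a, ha, _, hb, rfl⟩ := Submodule.mem_sup.mp hx
      obtain ⟨s, rfl⟩ := Submodule.mem_span_singleton.mp hb
      by_cases hs : s = 0
      · subst hs
        rw [zero_smul, add_zero] at hxN ⊢
        exact (Submodule.disjoint_def.mp (hHN i)) a ha hxN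
      · refine absurd ?_ (huW i)
        have hperp : a + s • u ∈ ω.orthogonal H :=
          Submodule.add_mem _ (hHorth ha) (Submodule.smul_mem _ s hu)
        have : s • u ∈ H ⊔ (N i ⊓ ω.orthogonal H) := by
          have h := Submodule.sub_mem _ (Submodule.mem_sup_right (S := H)
            (Submodule.mem_inf.mpr ⟨hxN, hperp⟩))
            (Submodule.mem_sup_left (T := N i ⊓ ω.orthogonal H) ha)
          simpa using h
        exact (Submodule.smul_mem_iff _ hs).mp this

/-- The matrix of values of `ω` on two tuples. -/
def formMatrix (ω : LinearMap.BilinForm F V) (x y : Fin n → V) : Matrix (Fin n) (Fin n) F :=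
  Matrix.of fun i j => ω (x i) (y j)

theorem formMatrix_mulVec (x y : Fin n → V) (t : Fin n → F) (i : Fin n) :
    (formMatrix ω x y *ᵥ t) i = ω (x i) (∑ j, t j • y j) := by
  simp [formMatrix, Matrix.mulVec, dotProduct, mul_comm]

/-- The basis of a Lagrangian `M` dual to a basis of a transversal Lagrangian. -/
theorem exists_dual_basis [FiniteDimensional F V] (hω' : ω.Nondegenerate)
    (hV : finrank F V = 2 * n) {X M : Submodule F V} (hX : IsLagrangian ω X)
    (hM : IsLagrangian ω M) (hXM : Disjoint X M) (x : Basis (Fin n) F X) :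
    ∃ e : Basis (Fin n) F M, formMatrix ω (fun i => x i) (fun j => e j) = 1 := by
  let f : M →ₗ[F] Fin n → F := LinearMap.pi fun i => (ω (x i)).comp M.subtype
  -- The kernel is `M ∩ Xᗮ = M ∩ X = 0`.
  have hf : Function.Injective f := by
    rw [← LinearMap.ker_eq_bot, LinearMap.ker_eq_bot']
    intro m hm
    have hmX : (m : V) ∈ X := by
      rw [hX.mem_iff]
      intro y hy
      have : (ω.flip (m : V)).comp X.subtype = 0 := x.ext fun i => congrFun hm i
      exact LinearMap.congr_fun this ⟨y, hy⟩
    exact Subtype.ext (Submodule.disjoint_def.mp hXM _ hmX m.2)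
  let e := Basis.ofEquivFun (LinearEquiv.ofInjectiveOfFinrankEq f hf
    (by rw [hM.finrank_eq hω' hV]; simp))
  refine ⟨e, Matrix.ext fun i j => ?_⟩
  have h : f (e j) = Pi.single j 1 := by
    rw [show e j = _ from congrFun (Basis.coe_ofEquivFun _) j]
    exact (LinearEquiv.ofInjectiveOfFinrankEq f hf _).apply_symm_apply (Pi.single j 1)
  have h' := congrFun h i
  rw [Pi.single_apply] at h'
  rw [Matrix.one_apply]
  exact h'

theorem exists_smul_ιMulti_eq {M : Type*} [AddCommGroup M] [Module F M] (e : Basis (Fin n) F M)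
    (σ : ⋀[F]^n M) : ∃ c : F, σ = c • exteriorPower.ιMulti F n e := by
  have h1 : finrank F (⋀[F]^n M) = 1 := by
    have : Module.Finite F M := Module.Finite.of_basis e
    rw [exteriorPower.finrank_eq, finrank_eq_card_basis e]; simp
  have h2 : exteriorPower.ιMulti F n e ≠ 0 := by
    intro h
    have := exteriorPower.alternatingMapLinearEquiv_apply_ιMulti e.det e
    rw [h, map_zero, e.det_self] at this
    exact zero_ne_one this
  obtain ⟨c, hc⟩ := (finrank_eq_one_iff_of_nonzero' _ h2).mp h1 σ
  exact ⟨c, hc.symm⟩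

/-- The alternating form `b ↦ det (ω (x i) (b j))` on a subspace. -/
noncomputable def pairingForm (ω : LinearMap.BilinForm F V) (x : Fin n → V) (M : Submodule F V) :
    M [⋀^Fin n]→ₗ[F] F :=
  (Matrix.detRowAlternating (R := F) (n := Fin n)).compLinearMap
    (LinearMap.pi fun i => (ω (x i)).comp M.subtype)

theorem pairingForm_apply (x : Fin n → V) (M : Submodule F V) (b : Fin n → M) :
    pairingForm ω x M b = (formMatrix ω x (fun j => b j)).det := by
  rw [← Matrix.det_transpose]
  rfl

/-- The pairing of a tuple with the volume element of an enhanced Lagrangian. -/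
noncomputable def pairing (x : Fin n → V) (M : EnhancedLagrangian ω n) : F :=
  exteriorPower.alternatingMapLinearEquiv (pairingForm ω x M.L) M.σ

theorem pairing_smul (x : Fin n → V) (a : Fˣ) (M : EnhancedLagrangian ω n) :
    pairing x (a • M) = a * pairing x M :=
  map_smul (exteriorPower.alternatingMapLinearEquiv (pairingForm ω x M.L)) (a : F) M.σ

theorem pairing_of_eq_smul (x : Fin n → V) {M : EnhancedLagrangian ω n} {c : F} {b : Fin n → M.L}
    (h : M.σ = c • exteriorPower.ιMulti F n b) :
    pairing x M = c * (formMatrix ω x (fun j => b j)).det := by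
  rw [pairing, h, map_smul, exteriorPower.alternatingMapLinearEquiv_apply_ιMulti,
    pairingForm_apply, smul_eq_mul]

theorem pairing_sp_smul (g : Sp ω) (x : Fin n → V) (M : EnhancedLagrangian ω n) :
    pairing (fun i => g.1 (x i)) (g • M) = pairing x M := by
  have h : (exteriorPower.alternatingMapLinearEquiv
      (pairingForm ω (fun i => g.1 (x i)) (g • M).L)).comp
        (exteriorPower.map n (g.1.submoduleMap M.L).toLinearMap) =
      exteriorPower.alternatingMapLinearEquiv (pairingForm ω x M.L) := by
    refine exteriorPower.linearMap_ext ?_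
    ext b
    simp only [LinearMap.compAlternatingMap_apply, LinearMap.comp_apply]
    rw [exteriorPower.map_apply_ιMulti]
    erw [exteriorPower.alternatingMapLinearEquiv_apply_ιMulti]
    rw [exteriorPower.alternatingMapLinearEquiv_apply_ιMulti, pairingForm_apply]
    erw [pairingForm_apply]
    congr 1
    ext i j
    exact g.2 _ _
  exact LinearMap.congr_fun h M.σ

/-- An enhanced Lagrangian on the Lagrangian subspace `X`. -/
theorem exists_enhanced [FiniteDimensional F V] (hω' : ω.Nondegenerate)
    (hV : finrank F V = 2 * n) {X : Submodule F V} (hX : IsLagrangian ω X) :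
    ∃ P : EnhancedLagrangian ω n, P.L = X := by
  let e := Module.finBasisOfFinrankEq F X (hX.finrank_eq hω' hV)
  refine ⟨⟨X, hX, exteriorPower.ιMulti F n e, fun h => ?_⟩, rfl⟩
  have := exteriorPower.alternatingMapLinearEquiv_apply_ιMulti e.det e
  rw [h, map_zero, e.det_self] at this
  exact zero_ne_one this

theorem exists_transversal [FiniteDimensional F V] (h2 : (2 : F) ≠ 0) (hω : ω.IsAlt)
    (hω' : ω.Nondegenerate) (hV : finrank F V = 2 * n) (N M L : EnhancedLagrangian ω n) :
    ∃ X : EnhancedLagrangian ω n, Disjoint X.L N.L ∧ Disjoint X.L M.L ∧ Disjoint X.L L.L := by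
  obtain ⟨H, h1, h3, h4⟩ := exists_isotropic_disjoint (N := ![N.L, M.L, L.L]) h2 hω hω' hV
    (fun i => by
      fin_cases i
      exacts [N.isLagrangian, M.isLagrangian, L.isLagrangian]) n le_rfl
  obtain ⟨X, rfl⟩ := exists_enhanced hω' hV (isLagrangian_of_finrank hω' hV h1 h3)
  exact ⟨X, h4 0, h4 1, h4 2⟩

/-- The coordinates with respect to the dual basis are the values of `ω` on the original one. -/
theorem sum_form_smul_dual {X M : Submodule F V} {x : Fin n → X} {e : Basis (Fin n) F M}
    (hxe : formMatrix ω (fun i => x i) (fun j => e j) = 1) {m : V} (hm : m ∈ M) :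
    ∑ i, ω (x i) m • (e i : V) = m := by
  have h1 : m = ∑ j, e.repr ⟨m, hm⟩ j • (e j : V) := by
    have h := congrArg M.subtype (e.sum_repr ⟨m, hm⟩)
    rw [map_sum] at h
    exact h.symm
  have h2 (i : Fin n) : ω (x i) m = e.repr ⟨m, hm⟩ i := by
    have h3 (j : Fin n) : ω (x i) (e j) = if i = j then 1 else 0 := by
      rw [← Matrix.one_apply, ← hxe]; rfl
    conv_lhs => rw [h1]
    simp [h3]
  simp only [h2]
  exact h1.symm

section DualPair

variable {X M N : Submodule F V} {x : Basis (Fin n) F X} {e : Basis (Fin n) F M}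
  {f : Basis (Fin n) F N}

/-- Both dual bases have the same values against `x`, so `f j - e j` lies in `Xᗮ = X`. -/
theorem dual_sub_mem (hX : IsLagrangian ω X)
    (hxe : formMatrix ω (fun i => x i) (fun j => e j) = 1)
    (hxf : formMatrix ω (fun i => x i) (fun j => f j) = 1) (t : Fin n → F) :
    ∑ j, t j • (f j : V) - ∑ j, t j • (e j : V) ∈ X := by
  rw [← Finset.sum_sub_distrib]
  refine X.sum_mem fun j _ => ?_
  rw [← smul_sub]
  refine X.smul_mem _ (hX.mem_iff.mpr fun y hy => ?_)
  have : (ω.flip ((f j : V) - e j)).comp X.subtype = 0 := x.ext fun i => by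
    have h1 := congrFun (congrFun hxe i) j
    have h2 := congrFun (congrFun hxf i) j
    simp only [formMatrix, Matrix.of_apply] at h1 h2
    simp [h1, h2]
  exact LinearMap.congr_fun this ⟨y, hy⟩

/-- Expand `ω(f i - e i, f j - e j) = 0`, which holds because these differences lie in the isotropic
`X`; the terms within `M` and within `N` vanish. -/
theorem formMatrix_isSymm (hω : ω.IsAlt) (hX : IsLagrangian ω X) (hM : IsLagrangian ω M)
    (hN : IsLagrangian ω N) (hxe : formMatrix ω (fun i => x i) (fun j => e j) = 1)
    (hxf : formMatrix ω (fun i => x i) (fun j => f j) = 1) :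
    (formMatrix ω (fun i => e i) (fun j => f j)).IsSymm := by
  ext i j
  have h (k : Fin n) : (f k : V) - e k ∈ X := by
    simpa [Pi.single_apply] using dual_sub_mem hX hxe hxf (Pi.single k 1)
  have h1 := hX.apply_eq_zero (h i) (h j)
  simp only [map_sub, LinearMap.sub_apply, hN.apply_eq_zero (f i).2 (f j).2,
    hM.apply_eq_zero (e i).2 (e j).2] at h1
  rw [← hω.neg_eq (e j : V)] at h1
  change ω (e j) (f i) = ω (e i) (f j)
  linear_combination h1

/-- The kernel of the form is `M ∩ N` in coordinates: `∑ t j • f j` is orthogonal to `M`, hence in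
`M`, and its difference from `∑ t j • e j` lies in `X ∩ M = 0`. -/
theorem dual_eq_of_mulVec_eq_zero (hX : IsLagrangian ω X) (hM : IsLagrangian ω M)
    (hXM : Disjoint X M) (hxe : formMatrix ω (fun i => x i) (fun j => e j) = 1)
    (hxf : formMatrix ω (fun i => x i) (fun j => f j) = 1) {t : Fin n → F}
    (ht : formMatrix ω (fun i => e i) (fun j => f j) *ᵥ t = 0) :
    ∑ j, t j • (f j : V) = ∑ j, t j • (e j : V) := by
  have hu : ∑ j, t j • (e j : V) ∈ M := M.sum_mem fun j _ => M.smul_mem _ (e j).2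
  have hw : ∑ j, t j • (f j : V) ∈ M := by
    refine hM.mem_iff.mpr fun y hy => ?_
    have : (ω.flip (∑ j, t j • (f j : V))).comp M.subtype = 0 := e.ext fun i => by
      have h := congrFun ht i
      simp only [Matrix.mulVec, dotProduct, formMatrix, Matrix.of_apply, Pi.zero_apply] at h
      simpa [mul_comm] using h
    exact LinearMap.congr_fun this ⟨y, hy⟩
  exact sub_eq_zero.mp (Submodule.disjoint_def.mp hXM _ (dual_sub_mem hX hxe hxf t)
    (M.sub_mem hw hu))

end DualPair

theorem formMatrix_mul_formMatrix {X M : Submodule F V} {x : Fin n → X} {e : Basis (Fin n) F M}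
    (hxe : formMatrix ω (fun i => x i) (fun j => e j) = 1) (y : Fin n → V) (z : Fin n → M) :
    formMatrix ω y (fun j => e j) * formMatrix ω (fun i => x i) (fun j => z j) =
      formMatrix ω y (fun j => z j) := by
  ext i k
  simp only [Matrix.mul_apply, formMatrix, Matrix.of_apply]
  conv_rhs => rw [← sum_form_smul_dual hxe (z k).2]
  simp [mul_comm]

theorem formMatrix_transpose (hω : ω.IsAlt) (x y : Fin n → V) :
    (formMatrix ω x y)ᵀ = - formMatrix ω y x := by
  ext i j
  simp [formMatrix, hω.neg_eq]

theorem pairing_eq_mul_det {X Y : Submodule F V} {M : EnhancedLagrangian ω n} {x : Fin n → X}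
    {y : Fin n → Y} {e : Basis (Fin n) F M.L}
    (hye : formMatrix ω (fun i => y i) (fun j => e j) = 1) :
    pairing (fun i => (x i : V)) M =
      pairing (fun i => (y i : V)) M * (formMatrix ω (fun i => x i) (fun j => e j)).det := by
  obtain ⟨c, hc⟩ := exists_smul_ιMulti_eq e M.σ
  rw [pairing_of_eq_smul _ hc, pairing_of_eq_smul _ hc, hye, det_one, mul_one]

theorem pairing_ne_zero [FiniteDimensional F V] (hω' : ω.Nondegenerate)
    (hV : finrank F V = 2 * n) {X : Submodule F V} (hX : IsLagrangian ω X)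
    {M : EnhancedLagrangian ω n} (hXM : Disjoint X M.L) (x : Basis (Fin n) F X) :
    pairing (fun i => (x i : V)) M ≠ 0 := by
  obtain ⟨e, he⟩ := exists_dual_basis hω' hV hX M.isLagrangian hXM x
  obtain ⟨c, hc⟩ := exists_smul_ιMulti_eq e M.σ
  rw [pairing_of_eq_smul _ hc, he, det_one, mul_one]
  rintro rfl
  exact M.σ_ne_zero (by rw [hc, zero_smul])

/-- The signed Gauss sum of a pair of enhanced Lagrangians does not depend on the auxiliary
transversal Lagrangian. -/
theorem legendre_mul_quadGauss_eq [Fintype F] [DecidableEq F] (hF : ringChar F ≠ 2)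
    {ψ : AddChar F ℂ} (hψ : ψ ≠ 1) (hω : ω.IsAlt) {N M : EnhancedLagrangian ω n}
    {X Y : Submodule F V} (hX : IsLagrangian ω X) (hY : IsLagrangian ω Y) (hXM : Disjoint X M.L)
    {x : Basis (Fin n) F X} {y : Basis (Fin n) F Y} {e e' : Basis (Fin n) F M.L}
    {f f' : Basis (Fin n) F N.L} (hxe : formMatrix ω (fun i => x i) (fun j => e j) = 1)
    (hxf : formMatrix ω (fun i => x i) (fun j => f j) = 1)
    (hye : formMatrix ω (fun i => y i) (fun j => e' j) = 1)
    (hyf : formMatrix ω (fun i => y i) (fun j => f' j) = 1) :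
    legendre (pairing (fun i => (x i : V)) N) * legendre (pairing (fun i => (x i : V)) M) *
        quadGauss ψ (formMatrix ω (fun i => e i) (fun j => f j)) =
      legendre (pairing (fun i => (y i : V)) N) * legendre (pairing (fun i => (y i : V)) M) *
        quadGauss ψ (formMatrix ω (fun i => e' i) (fun j => f' j)) := by
  -- `A` and `B` are the transition matrices from `e` to `e'` and from `f` to `f'`.
  set A := formMatrix ω (fun i => x i) (fun j => e' j) with hA
  set B := formMatrix ω (fun i => x i) (fun j => f' j) with hB
  set S := formMatrix ω (fun i => e i) (fun j => f j) with hS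
  set S' := formMatrix ω (fun i => e' i) (fun j => f' j) with hS'
  have hAinv : A * formMatrix ω (fun i => y i) (fun j => e j) = 1 := by
    rw [hA, formMatrix_mul_formMatrix hye, hxe]
  have hBinv : B * formMatrix ω (fun i => y i) (fun j => f j) = 1 := by
    rw [hB, formMatrix_mul_formMatrix hyf, hxf]
  have hAdet : IsUnit A.det := isUnit_det_of_right_inverse hAinv
  have hBdet : IsUnit B.det := isUnit_det_of_right_inverse hBinv
  have hAT : IsUnit Aᵀ.det := by rwa [det_transpose]
  have hSB : S * B = formMatrix ω (fun i => e i) (fun j => f' j) :=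
    formMatrix_mul_formMatrix hxf _ _
  have hS'eq : S' = Aᵀ * (S * B) := by
    have h := formMatrix_mul_formMatrix (ω := ω) hxe (fun i => (f' i : V)) e'
    rw [hSB, ← neg_neg (formMatrix ω (fun i => (e i : V)) _), ← formMatrix_transpose hω, ← neg_inj,
      ← formMatrix_transpose hω, ← h, transpose_mul, Matrix.mul_neg, neg_neg]
  have hSsymm : S.IsSymm := formMatrix_isSymm hω hX M.isLagrangian N.isLagrangian hxe hxf
  have hS'symm : S'.IsSymm := formMatrix_isSymm hω hY M.isLagrangian N.isLagrangian hye hyf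
  -- `S' = Aᵀ S B` is congruent through `A` to `S C` with `C = B A⁻¹`, so `quadGauss_mul` applies
  -- once `C` is known to fix `ker S`.
  have hcongr : Aᵀ * (S * (B * A⁻¹)) * A = S' := by
    rw [hS'eq]
    simp only [Matrix.mul_assoc, nonsing_inv_mul A hAdet, Matrix.mul_one]
  have hcongr' : S * (B * A⁻¹) = (A⁻¹)ᵀ * S' * A⁻¹ := by
    rw [hS'eq, transpose_nonsing_inv, ← Matrix.mul_assoc Aᵀ⁻¹, nonsing_inv_mul _ hAT,
      Matrix.one_mul, Matrix.mul_assoc]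
  have hCsymm : (S * (B * A⁻¹)).IsSymm := by
    rw [hcongr', Matrix.IsSymm, transpose_mul, transpose_mul, transpose_transpose, hS'symm.eq,
      Matrix.mul_assoc]
  have hCdet : (B * A⁻¹).det ≠ 0 := by
    rw [det_mul]
    exact mul_ne_zero hBdet.ne_zero (A.isUnit_nonsing_inv_det hAdet).ne_zero
  -- A kernel vector is `t = A s`, the `e`-coordinates of some `w ∈ M ∩ N`. Pairing with `y` shows
  -- that `s` gives the coordinates of `w` in both `e'` and `f'`, so `B s` and `A s` are both the
  -- values of `ω (x i)` on `w`.
  have hker : ∀ t, S *ᵥ t = 0 → (B * A⁻¹) *ᵥ t = t := by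
    intro t ht
    obtain ⟨s, rfl⟩ : ∃ s, A *ᵥ s = t :=
      ⟨A⁻¹ *ᵥ t, by rw [mulVec_mulVec, mul_nonsing_inv A hAdet, one_mulVec]⟩
    rw [mulVec_mulVec, Matrix.mul_assoc, nonsing_inv_mul A hAdet, Matrix.mul_one]
    set w : V := ∑ j, s j • (e' j : V) with hw
    have hwM : w ∈ M.L := M.L.sum_mem fun j _ => M.L.smul_mem _ (e' j).2
    have hAs (i : Fin n) : (A *ᵥ s) i = ω (x i) w := formMatrix_mulVec ..
    have hwN : w ∈ N.L := by
      have h := dual_eq_of_mulVec_eq_zero hX M.isLagrangian hXM hxe hxf ht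
      simp only [hAs] at h
      rw [sum_form_smul_dual hxe hwM] at h
      rw [← h]
      exact N.L.sum_mem fun j _ => N.L.smul_mem _ (f j).2
    have hs (i : Fin n) : s i = ω (y i) w := by
      have h := formMatrix_mulVec (ω := ω) (fun i => (y i : V)) (fun j => (e' j : V)) s i
      rwa [hye, one_mulVec] at h
    have hw' : ∑ j, s j • (f' j : V) = w := by
      simp only [hs]
      exact sum_form_smul_dual hyf hwN
    ext i
    rw [hAs]
    exact (formMatrix_mulVec ..).trans (by rw [hw'])
  have hlegA : legendre (A⁻¹).det = legendre A.det := by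
    have h1 : legendre A.det * legendre (A⁻¹).det = 1 := by
      rw [← legendre_mul, ← det_mul, mul_nonsing_inv A hAdet, det_one, legendre_one]
    exact mul_left_cancel₀ (legendre_ne_zero hAdet.ne_zero)
      (h1.trans (legendre_mul_self hAdet.ne_zero).symm)
  rw [← hcongr, quadGauss_congruence ψ _ hAdet, quadGauss_mul hF hψ hSsymm hCsymm hCdet hker,
    pairing_eq_mul_det (x := x) hye, pairing_eq_mul_det (x := x) hyf, det_mul, legendre_mul,
    legendre_mul, legendre_mul, hlegA]
  ring

end Geometry

end FiniteHeisenberg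

namespace FiniteHeisenberg

open Matrix Module

/-! ### Intertwiners between models and averaging operators. -/

section Models

variable {F : Type*} [Field F] {V : Type*} [AddCommGroup V] [Module F V]
  {ω : LinearMap.BilinForm F V} {n : ℕ} {ψ : AddChar F ℂ}

namespace Heis

theorem finite [Finite F] [Finite V] : Finite (Heis ω) :=
  Finite.of_injective (fun h : Heis ω => (h.vec, h.ctr)) fun a b h => by
    ext
    exacts [congrArg Prod.fst h, congrArg Prod.snd h]

end Heis

theorem Model.apply_mul {P : EnhancedLagrangian ω n} (f : Model ψ P) {l : Heis ω}
    (hl : l.vec ∈ P.L) (h : Heis ω) : f.1 (l * h) = ψ l.ctr * f.1 h :=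
  f.2 l hl h

open Classical in
/-- The function supported on `L × F` given there by the inducing character. -/
noncomputable def modelDelta (ψ : AddChar F ℂ) (P : EnhancedLagrangian ω n) : Model ψ P :=
  ⟨fun h => if h.vec ∈ P.L then ψ h.ctr else 0, fun l hl h => by
    have h1 : (l * h).vec ∈ P.L ↔ h.vec ∈ P.L := P.L.add_mem_iff_right hl
    simp only [h1]
    split_ifs with hh
    · simp [P.isLagrangian.apply_eq_zero hl hh, AddChar.map_add_eq_mul]
    · simp⟩

open Classical in
theorem modelDelta_apply (P : EnhancedLagrangian ω n) (h : Heis ω) :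
    (modelDelta ψ P).1 h = if h.vec ∈ P.L then ψ h.ctr else 0 :=
  rfl

theorem modelDelta_one (P : EnhancedLagrangian ω n) : (modelDelta ψ P).1 1 = 1 := by
  simp [modelDelta_apply]

theorem modelRep_modelDelta {P : EnhancedLagrangian ω n} {l : Heis ω} (hl : l.vec ∈ P.L) :
    modelRep ψ P l (modelDelta ψ P) = ψ l.ctr • modelDelta ψ P := by
  ext h
  change (modelDelta ψ P).1 (h * l) = ψ l.ctr * (modelDelta ψ P).1 h
  have h1 : (h * l).vec ∈ P.L ↔ h.vec ∈ P.L := P.L.add_mem_iff_left hl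
  by_cases hh : h.vec ∈ P.L
  · rw [modelDelta_apply, modelDelta_apply, if_pos (h1.mpr hh), if_pos hh]
    simp [P.isLagrangian.apply_eq_zero hh hl, AddChar.map_add_eq_mul, mul_comm]
  · rw [modelDelta_apply, modelDelta_apply, if_neg (mt h1.mp hh), if_neg hh, mul_zero]

/-- The translates of `modelDelta` span the model. -/
theorem Model.smul_eq_sum [Fintype (Heis ω)] (P : EnhancedLagrangian ω n) :
    ∃ c : ℂ, c ≠ 0 ∧ ∀ f : Model ψ P,
      c • f = ∑ k, f.1 k • modelRep ψ P k⁻¹ (modelDelta ψ P) := by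
  classical
  -- The constant is the order of `P.L × F`: at `h`, exactly the `k` in the coset of `h` contribute,
  -- each giving `f h`.
  refine ⟨(Finset.univ.filter fun k : Heis ω => k.vec ∈ P.L).card, ?_, fun f => ?_⟩
  · rw [Nat.cast_ne_zero]
    exact Finset.card_ne_zero_of_mem (a := 1) (by simp)
  · ext h
    have key (k : Heis ω) : f.1 k * (modelDelta ψ P).1 (h * k⁻¹) =
        if (h * k⁻¹).vec ∈ P.L then f.1 h else 0 := by
      rw [modelDelta_apply]
      split_ifs with hk
      · rw [mul_comm, ← Model.apply_mul f hk, inv_mul_cancel_right]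
      · rw [mul_zero]
    have hsum : (∑ k, f.1 k • modelRep ψ P k⁻¹ (modelDelta ψ P)).1 h =
        ∑ k, f.1 k * (modelDelta ψ P).1 (h * k⁻¹) := by
      rw [Submodule.coe_sum, Finset.sum_apply]
      rfl
    rw [hsum, Finset.sum_congr rfl fun k _ => key k,
      Fintype.sum_equiv ((Equiv.inv _).trans (Equiv.mulLeft h))
        (fun k => if (h * k⁻¹).vec ∈ P.L then f.1 h else 0)
        (fun k => if k.vec ∈ P.L then f.1 h else 0) (fun _ => rfl),
      ← Finset.sum_filter, Finset.sum_const, nsmul_eq_mul]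
    rfl

/-- A vector of a model on which the subgroup `P.L × F` acts by the inducing character is determined
by its value at the identity. -/
theorem Model.eq_of_apply_one_eq [FiniteDimensional F V] (hω : ω.IsAlt) (hω' : ω.Nondegenerate)
    (h2 : (2 : F) ≠ 0) (hψ : ψ ≠ 1) {Q P : EnhancedLagrangian ω n} {u u' : Model ψ Q}
    (hu : ∀ l : Heis ω, l.vec ∈ P.L → modelRep ψ Q l u = ψ l.ctr • u)
    (hu' : ∀ l : Heis ω, l.vec ∈ P.L → modelRep ψ Q l u' = ψ l.ctr • u')
    (h1 : u.1 1 = u'.1 1) : u = u' := by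
  have hr {u : Model ψ Q} (hu : ∀ l : Heis ω, l.vec ∈ P.L → modelRep ψ Q l u = ψ l.ctr • u)
      {l : Heis ω} (hl : l.vec ∈ P.L) (h : Heis ω) : u.1 (h * l) = ψ l.ctr * u.1 h :=
    congrFun (congrArg Subtype.val (hu l hl)) h
  ext h
  by_cases hh : h.vec ∈ Q.L ⊔ P.L
  -- Over `Q.L + P.L`, left equivariance under `Q.L × F` and right equivariance under `P.L` reduce
  -- the value to that at `1`.
  · obtain ⟨q, hq, p, hp, hqp⟩ := Submodule.mem_sup.mp hh
    have hfac : h = (⟨q, h.ctr - 2⁻¹ * ω q p⟩ : Heis ω) * (⟨p, 0⟩ * 1) := by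
      ext <;> simp [hqp]
    have hval {u : Model ψ Q} (hu : ∀ l : Heis ω, l.vec ∈ P.L → modelRep ψ Q l u = ψ l.ctr • u) :
        u.1 h = ψ (h.ctr - 2⁻¹ * ω q p) * u.1 1 := by
      have h3 : u.1 (⟨p, 0⟩ * 1) = u.1 1 := by
        have := hr hu (l := ⟨p, 0⟩) hp 1
        rwa [one_mul, AddChar.map_zero_eq_one, one_mul, ← mul_one (⟨p, 0⟩ : Heis ω)] at this
      rw [← h3, ← Model.apply_mul u (l := ⟨q, _⟩) hq, ← hfac]
    rw [hval hu, hval hu', h1]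
  -- Elsewhere the vector vanishes: some `i ∈ Q.L ∩ P.L = (Q.L + P.L)ᗮ` fails to be orthogonal to
  -- `h.vec`, and moving a multiple of `i` past `h` costs a central element.
  · obtain ⟨i, hiQ, hiP, hi⟩ : ∃ i, i ∈ Q.L ∧ i ∈ P.L ∧ ω i h.vec ≠ 0 := by
      by_contra! hcon
      refine hh ?_
      rw [← LinearMap.BilinForm.orthogonal_orthogonal hω' hω.isRefl (Q.L ⊔ P.L)]
      intro i hi
      refine hcon i ?_ ?_
      · exact Q.isLagrangian.mem_iff.mpr fun y hy => hi y (Submodule.mem_sup_left hy)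
      · exact P.isLagrangian.mem_iff.mpr fun y hy => hi y (Submodule.mem_sup_right hy)
    obtain ⟨c, hc⟩ := AddChar.ne_one_iff.mp hψ
    have hzero {u : Model ψ Q}
        (hu : ∀ l : Heis ω, l.vec ∈ P.L → modelRep ψ Q l u = ψ l.ctr • u) : u.1 h = 0 := by
      -- Scaled so that the commutator is exactly `(0, c)`, where `ψ c ≠ 1`.
      set s : F := c / ω i h.vec with hs
      have e1 := Model.apply_mul u (l := ⟨s • i, 0⟩) (Q.L.smul_mem s hiQ) h
      have e2 := hr hu (l := ⟨s • i, 0⟩) (P.L.smul_mem s hiP) h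
      have e3 : (⟨s • i, 0⟩ * h : Heis ω) = ⟨0, c⟩ * (h * ⟨s • i, 0⟩) := by
        have hsi : s * ω i h.vec = c := div_mul_cancel₀ c hi
        have hflip : ω h.vec i = - ω i h.vec := (hω.neg_eq _ _).symm
        ext
        · simp [add_comm]
        · simp only [Heis.mul_ctr, Heis.mul_vec, map_smul, LinearMap.smul_apply, smul_eq_mul,
            map_zero, LinearMap.zero_apply, hflip, ← hsi]
          field_simp
          ring
      have e4 := Model.apply_mul u (l := ⟨0, c⟩) Q.L.zero_mem (h * ⟨s • i, 0⟩)
      rw [← e3, e1, e2] at e4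
      simp only [AddChar.map_zero_eq_one, one_mul] at e4
      have e5 : (ψ c - 1) * u.1 h = 0 := by linear_combination -e4
      exact (mul_eq_zero.mp e5).resolve_left (sub_ne_zero.mpr hc)
    rw [hzero hu, hzero hu']

/-- An intertwining operator between models is determined by one value. -/
theorem intertwiner_ext [Finite F] [FiniteDimensional F V] (hω : ω.IsAlt) (hω' : ω.Nondegenerate)
    (h2 : (2 : F) ≠ 0) (hψ : ψ ≠ 1) {Q P : EnhancedLagrangian ω n} {Φ Φ' : Intertwiners ψ Q P}
    (h : (Φ (modelDelta ψ P)).1 1 = (Φ' (modelDelta ψ P)).1 1) : Φ = Φ' := by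
  have : Finite V := Module.finite_of_finite F
  have := Heis.finite (ω := ω)
  have := Fintype.ofFinite (Heis ω)
  have hdelta (Φ : Intertwiners ψ Q P) (l : Heis ω) (hl : l.vec ∈ P.L) :
      modelRep ψ Q l (Φ (modelDelta ψ P)) = ψ l.ctr • Φ (modelDelta ψ P) := by
    rw [← Φ.isIntertwining, modelRep_modelDelta hl, map_smul]
  have hΦ := Model.eq_of_apply_one_eq hω hω' h2 hψ (hdelta Φ) (hdelta Φ') h
  obtain ⟨c, hc, hsum⟩ := Model.smul_eq_sum (ψ := ψ) P
  ext1
  ext1 f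
  rw [← (smul_right_injective _ hc).eq_iff, ← map_smul, ← map_smul, hsum, map_sum, map_sum]
  refine Finset.sum_congr rfl fun k _ => ?_
  rw [map_smul, map_smul]
  congr 1
  exact (Φ.isIntertwining ..).trans ((congrArg _ hΦ).trans (Φ'.isIntertwining ..).symm)

variable [∀ L : Submodule F V, Fintype L]

/-- The operator `f ↦ ∑ m ∈ M, f(m h)`. -/
noncomputable def averaging (ψ : AddChar F ℂ) (Q P : EnhancedLagrangian ω n) :
    Intertwiners ψ Q P where
  toFun f := ⟨fun h => ∑ m : Q.L, f.1 (⟨m, 0⟩ * h), fun l hl h => by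
    rw [Finset.mul_sum]
    refine Fintype.sum_equiv (Equiv.addRight ⟨l.vec, hl⟩) _ _ fun m => ?_
    have h1 : (⟨m, 0⟩ * (l * h) : Heis ω) =
        ⟨0, l.ctr⟩ * (⟨(Equiv.addRight ⟨l.vec, hl⟩ m : Q.L), 0⟩ * h) := by
      have h2 := Q.isLagrangian.apply_eq_zero m.2 hl
      ext
      · simp [add_assoc]
      · simp [h2]
        ring
    rw [h1, Model.apply_mul f P.L.zero_mem]⟩
  map_add' f f' := by
    ext h
    exact Finset.sum_add_distrib
  map_smul' c f := by
    ext h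
    exact (Finset.mul_sum ..).symm
  isIntertwining' k := by
    ext f h
    change ∑ m : Q.L, f.1 (⟨m, 0⟩ * h * k) = ∑ m : Q.L, f.1 (⟨m, 0⟩ * (h * k))
    simp only [mul_assoc]

theorem averaging_apply {Q P : EnhancedLagrangian ω n} (f : Model ψ P) (h : Heis ω) :
    (averaging ψ Q P f).1 h = ∑ m : Q.L, f.1 (⟨m, 0⟩ * h) :=
  rfl

/-- This links operators to Gauss sums. For `m = ∑ t j • f j` in `N`, the only `y ∈ X` with `y + m ∈
M` is `u - m`, where `u = ∑ t j • e j`; its term is `ψ(ω(u, m) / 2)`. -/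
theorem averaging_averaging_modelDelta [Fintype F] {N X M : EnhancedLagrangian ω n}
    (hXM : Disjoint X.L M.L) {x : Basis (Fin n) F X.L} {e : Basis (Fin n) F M.L}
    {f : Basis (Fin n) F N.L} (hxe : formMatrix ω (fun i => x i) (fun j => e j) = 1)
    (hxf : formMatrix ω (fun i => x i) (fun j => f j) = 1) :
    (averaging ψ N X (averaging ψ X M (modelDelta ψ M))).1 1 =
      quadGauss ψ (formMatrix ω (fun i => e i) (fun j => f j)) := by
  rw [averaging_apply, quadGauss]
  refine Fintype.sum_equiv f.equivFun.toEquiv _ _ fun m => ?_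
  set t : Fin n → F := f.equivFun m with ht
  change _ = ψ (2⁻¹ * (t ⬝ᵥ _ *ᵥ t))
  have hm : (m : V) = ∑ j, t j • (f j : V) := by
    have h := congrArg N.L.subtype (f.sum_equivFun m)
    rw [map_sum] at h
    exact h.symm
  set u : V := ∑ j, t j • (e j : V) with hu
  have huM : u ∈ M.L := M.L.sum_mem fun j _ => M.L.smul_mem _ (e j).2
  have hx₀ : u - m ∈ X.L := by
    rw [← neg_sub, hm]
    exact X.L.neg_mem (dual_sub_mem X.isLagrangian hxe hxf t)
  rw [averaging_apply, Finset.sum_eq_single ⟨u - m, hx₀⟩]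
  · rw [modelDelta_apply, if_pos (by simpa using huM)]
    congr 1
    have h1 : t ⬝ᵥ formMatrix ω (fun i => e i) (fun j => f j) *ᵥ t = ω u m := by
      rw [dotProduct, hu, map_sum, LinearMap.sum_apply]
      refine Finset.sum_congr rfl fun i _ => ?_
      rw [formMatrix_mulVec, ← hm, map_smul, LinearMap.smul_apply, smul_eq_mul]
    rw [h1]
    simp [N.isLagrangian.apply_eq_zero m.2 m.2]
  · intro y _ hy
    rw [modelDelta_apply, if_neg]
    intro hyM
    refine hy (Subtype.ext ?_)
    have h1 : (y : V) + m ∈ M.L := by simpa using hyM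
    have h2 := Submodule.disjoint_def.mp hXM ((y : V) - (u - m)) (X.L.sub_mem y.2 hx₀)
      (by
        have := M.L.sub_mem h1 huM
        rwa [show (y : V) - (u - m) = y + m - u by abel])
    exact sub_eq_zero.mp h2
  · simp

theorem averaging_sp_smul (g : Sp ω) (Q P : EnhancedLagrangian ω n) :
    (averaging ψ (g • Q) (g • P)).toLinearMap =
      (modelTransport ψ g Q).toLinearMap ∘ₗ (averaging ψ Q P).toLinearMap ∘ₗ
        (modelTransport ψ g P).symm.toLinearMap := by
  ext f h
  change ∑ m : (g • Q).L, f.1 (⟨m, 0⟩ * h) =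
    ∑ m : Q.L, f.1 (Sp.onHeis ω g (⟨m, 0⟩ * (Sp.onHeis ω g).symm h))
  refine (Fintype.sum_equiv (g.1.submoduleMap Q.L).toEquiv _ _ fun m => ?_).symm
  rw [map_mul, MulEquiv.apply_symm_apply]
  rfl

end Models

end FiniteHeisenberg

namespace FiniteHeisenberg

open Matrix Module

/-! ### Transitivity on symplectic bases and triviality of invariant cocycles. -/

section SymplecticBases

variable {F : Type*} [Field F] {V : Type*} [AddCommGroup V] [Module F V]
  {ω : LinearMap.BilinForm F V} {n : ℕ}

/-- A pair of tuples that satisfies the relations of a symplectic basis. -/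
structure IsSymplecticPair (ω : LinearMap.BilinForm F V) (e f : Fin n → V) : Prop where
  left : formMatrix ω e e = 0
  right : formMatrix ω f f = 0
  cross : formMatrix ω e f = 1

namespace IsSymplecticPair

variable {e f : Fin n → V}

theorem apply_left (h : IsSymplecticPair ω e f) (i j : Fin n) : ω (e i) (e j) = 0 :=
  congrFun (congrFun h.left i) j

theorem apply_right (h : IsSymplecticPair ω e f) (i j : Fin n) : ω (f i) (f j) = 0 :=
  congrFun (congrFun h.right i) j

theorem apply_cross (h : IsSymplecticPair ω e f) (i j : Fin n) :
    ω (e i) (f j) = if i = j then 1 else 0 := by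
  rw [← Matrix.one_apply, ← h.cross]
  rfl

theorem apply_cross' (hω : ω.IsAlt) (h : IsSymplecticPair ω e f) (i j : Fin n) :
    ω (f i) (e j) = if i = j then -1 else 0 := by
  rw [← hω.neg_eq, h.apply_cross]
  split_ifs <;> simp_all

theorem linearIndependent (hω : ω.IsAlt) (h : IsSymplecticPair ω e f) :
    LinearIndependent F (Sum.elim e f) := by
  rw [Fintype.linearIndependent_iff]
  intro c hc
  rw [Fintype.sum_sum_type] at hc
  simp only [Sum.elim_inl, Sum.elim_inr] at hc
  rintro (i | i)
  · have h1 := congrArg (ω (f i)) hc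
    simpa [h.apply_right, h.apply_cross' hω] using h1
  · have h1 := congrArg (ω (e i)) hc
    simpa [h.apply_left, h.apply_cross] using h1

theorem exists_basis [FiniteDimensional F V] (hω : ω.IsAlt) (hV : finrank F V = 2 * n)
    (h : IsSymplecticPair ω e f) : ∃ b : Basis (Fin n ⊕ Fin n) F V, ⇑b = Sum.elim e f := by
  have hli := h.linearIndependent hω
  have hcard : Fintype.card (Fin n ⊕ Fin n) = finrank F V := by simp [hV, two_mul]
  exact ⟨Basis.mk hli (hli.span_eq_top_of_card_eq_finrank' hcard).ge, Basis.coe_mk _ _⟩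

/-- The symplectic group is transitive on symplectic bases. -/
theorem exists_sp [FiniteDimensional F V] (hω : ω.IsAlt) (hV : finrank F V = 2 * n) (h : IsSymplecticPair ω e f)
    {e' f' : Fin n → V} (h' : IsSymplecticPair ω e' f') :
    ∃ g : Sp ω, (∀ i, g.1 (e i) = e' i) ∧ ∀ i, g.1 (f i) = f' i := by
  obtain ⟨b, hb⟩ := h.exists_basis hω hV
  obtain ⟨b', hb'⟩ := h'.exists_basis hω hV
  let g := b.equiv b' (Equiv.refl _)
  have hg (i) : g (Sum.elim e f i) = Sum.elim e' f' i := by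
    rw [← hb, ← hb']; exact b.equiv_apply _ _ _
  have hform : ω.compl₁₂ (g : V →ₗ[F] V) (g : V →ₗ[F] V) = ω := by
    refine LinearMap.ext_basis b b fun i j => ?_
    rw [LinearMap.compl₁₂_apply, hb]
    change ω (g _) (g _) = _
    rw [hg, hg]
    rcases i with i | i <;> rcases j with j | j <;>
      simp [h.apply_left, h'.apply_left, h.apply_right, h'.apply_right, h.apply_cross,
        h'.apply_cross, h.apply_cross' hω, h'.apply_cross' hω]
  exact ⟨⟨g, fun x y => LinearMap.congr_fun (LinearMap.congr_fun hform x) y⟩,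
    fun i => hg (Sum.inl i), fun i => hg (Sum.inr i)⟩

end IsSymplecticPair

variable [FiniteDimensional F V]

theorem EnhancedLagrangian.exists_units_smul (hω' : ω.Nondegenerate) (hV : finrank F V = 2 * n)
    {P Q : EnhancedLagrangian ω n} (h : P.L = Q.L) : ∃ a : Fˣ, P = a • Q := by
  obtain ⟨L, hL, σ, hσ⟩ := P
  obtain ⟨L', hL', σ', hσ'⟩ := Q
  obtain rfl : L = L' := h
  let e := Module.finBasisOfFinrankEq F L (hL.finrank_eq hω' hV)
  obtain ⟨c, rfl⟩ := exists_smul_ιMulti_eq e σ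
  obtain ⟨c', rfl⟩ := exists_smul_ιMulti_eq e σ'
  have hc : c ≠ 0 := by rintro rfl; simp at hσ
  have hc' : c' ≠ 0 := by rintro rfl; simp at hσ'
  refine ⟨Units.mk0 (c / c') (div_ne_zero hc hc'), ?_⟩
  change _ = (⟨L, hL, (c / c') • c' • _, _⟩ : EnhancedLagrangian ω n)
  congr 1
  rw [smul_smul, div_mul_cancel₀ c hc']

theorem EnhancedLagrangian.exists_units_smul_of_basis (hω' : ω.Nondegenerate)
    (hV : finrank F V = 2 * n) {P Q : EnhancedLagrangian ω n} (b : Basis (Fin n) F P.L) (g : Sp ω)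
    (h : ∀ i, g.1 (b i) ∈ Q.L) : ∃ a : Fˣ, g • P = a • Q := by
  refine exists_units_smul hω' hV (Submodule.eq_of_le_of_finrank_eq ?_ ?_)
  · rintro _ ⟨y, hy, rfl⟩
    have h1 : Submodule.span F (Set.range b) ≤
        Q.L.comap ((g.1 : V →ₗ[F] V).comp P.L.subtype) := by
      rw [Submodule.span_le]
      rintro _ ⟨i, rfl⟩
      exact h i
    rw [b.span_eq] at h1
    exact h1 (x := ⟨y, hy⟩) trivial
  · rw [(g • P).isLagrangian.finrank_eq hω' hV, Q.isLagrangian.finrank_eq hω' hV]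

/-- An invariant multiplicative cocycle on pairs of Lagrangians is trivial. -/
theorem cocycle_eq_one (h2 : (2 : F) ≠ 0) (hω : ω.IsAlt) (hω' : ω.Nondegenerate)
    (hV : finrank F V = 2 * n) {c : EnhancedLagrangian ω n → EnhancedLagrangian ω n → ℂ}
    (h1 : ∀ M, c M M = 1) (hmul : ∀ N M L, c N M * c M L = c N L)
    (hg : ∀ (g : Sp ω) N M, c (g • N) (g • M) = c N M)
    (hl : ∀ (a : Fˣ) N M, c (a • N) M = c N M) (hr : ∀ (a : Fˣ) N M, c N (a • M) = c N M)
    (N M : EnhancedLagrangian ω n) : c N M = 1 := by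
  have key (N M : EnhancedLagrangian ω n) (hNM : Disjoint N.L M.L) : c N M = 1 := by
    let e := Module.finBasisOfFinrankEq F M.L (M.isLagrangian.finrank_eq hω' hV)
    obtain ⟨f, hef⟩ := exists_dual_basis hω' hV M.isLagrangian N.isLagrangian hNM.symm e
    have hp : IsSymplecticPair ω (fun i => (e i : V)) (fun i => (f i : V)) :=
      ⟨Matrix.ext fun i j => M.isLagrangian.apply_eq_zero (e i).2 (e j).2,
        Matrix.ext fun i j => N.isLagrangian.apply_eq_zero (f i).2 (f j).2, hef⟩
    have hp1 : IsSymplecticPair ω (fun i => (e i : V)) (fun i => (e i + f i : V)) := by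
      refine ⟨hp.left, Matrix.ext fun i j => ?_, Matrix.ext fun i j => ?_⟩
      · simp [formMatrix, hp.apply_left, hp.apply_right, hp.apply_cross, hp.apply_cross' hω]
        split_ifs <;> simp
      · simp [formMatrix, hp.apply_left, hp.apply_cross, Matrix.one_apply]
    have hp2 : IsSymplecticPair ω (fun i => (f i : V)) (fun i => -(e i + f i : V)) := by
      refine ⟨hp.right, Matrix.ext fun i j => ?_, Matrix.ext fun i j => ?_⟩
      · simp [formMatrix, hp.apply_left, hp.apply_right, hp.apply_cross, hp.apply_cross' hω]
        split_ifs <;> simp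
      · simp [formMatrix, hp.apply_right, hp.apply_cross' hω, Matrix.one_apply]
        split_ifs <;> simp
    -- The shear `u` fixes `M` and moves `N` to the span of the `e i + f i`; `g` sends `M` to `N`
    -- and `N` to `u N`.
    obtain ⟨u, hue, huf⟩ := hp.exists_sp hω hV hp1
    obtain ⟨g, hge, hgf⟩ := hp.exists_sp hω hV hp2
    obtain ⟨a, ha⟩ := EnhancedLagrangian.exists_units_smul_of_basis hω' hV (Q := M) e u
      fun i => by rw [hue]; exact (e i).2
    obtain ⟨b, hb⟩ := EnhancedLagrangian.exists_units_smul_of_basis hω' hV (Q := N) e g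
      fun i => by rw [hge]; exact (f i).2
    obtain ⟨d, hd⟩ := EnhancedLagrangian.exists_units_smul_of_basis hω' hV (Q := u • N) f g
      fun i => by
        rw [hgf, ← huf]
        exact Submodule.neg_mem _ ⟨f i, (f i).2, rfl⟩
    have e1 : c (u • N) M = c N M := by rw [← hg u N M, ha, hr]
    have e2 : c (u • N) N = c N M := by rw [← hg g N M, hd, hb, hl, hr]
    -- With all three values equal to `c N M`, the cocycle identity becomes `c² = c`.
    have e3 := hmul (u • N) N M
    have hne : c N M ≠ 0 := left_ne_zero_of_mul_eq_one ((hmul N M N).trans (h1 N))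
    rw [e1, e2] at e3
    exact mul_left_cancel₀ hne (by rw [e3, mul_one])
  obtain ⟨X, hXN, hXM, -⟩ := exists_transversal h2 hω hω' hV N M M
  rw [← hmul N X M, key N X hXN.symm, key X M hXM, one_mul]

end SymplecticBases

/-! ### The normalized operators and their independence of the transversal. -/

section Canonical

variable {F : Type*} [Field F] [Fintype F] [DecidableEq F] {V : Type*} [AddCommGroup V]
  [Module F V] {ω : LinearMap.BilinForm F V} {n : ℕ} {ψ : AddChar F ℂ}
  [∀ L : Submodule F V, Fintype L]

/-- The normalized composition of two averaging operators through a transversal Lagrangian. -/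
noncomputable def intertwinerVia (ψ : AddChar F ℂ) (N M X : EnhancedLagrangian ω n)
    (x : Basis (Fin n) F X.L) : Intertwiners ψ N M :=
  (((Fintype.card F : ℂ) ^ n)⁻¹ * (legendre (pairing (fun i => (x i : V)) N) *
    legendre (pairing (fun i => (x i : V)) M))) • (averaging ψ N X).comp (averaging ψ X M)

theorem intertwinerVia_smul_left (a : Fˣ) (N M X : EnhancedLagrangian ω n)
    (x : Basis (Fin n) F X.L) :
    intertwinerVia ψ (a • N) M X x =
      ((quadraticChar F a : ℤ) : ℂ) • intertwinerVia ψ N M X x := by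
  refine Eq.trans (congrArg (fun c : ℂ => c • (averaging ψ N X).comp (averaging ψ X M)) ?_)
    (mul_smul (legendre (a : F)) _ _)
  rw [pairing_smul, legendre_mul]
  ring

theorem intertwinerVia_smul_right (a : Fˣ) (N M X : EnhancedLagrangian ω n)
    (x : Basis (Fin n) F X.L) :
    intertwinerVia ψ N (a • M) X x =
      ((quadraticChar F a : ℤ) : ℂ) • intertwinerVia ψ N M X x := by
  refine Eq.trans (congrArg (fun c : ℂ => c • (averaging ψ N X).comp (averaging ψ X M)) ?_)
    (mul_smul (legendre (a : F)) _ _)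
  rw [pairing_smul, legendre_mul]
  ring

theorem intertwinerVia_sp_smul (g : Sp ω) (N M X : EnhancedLagrangian ω n)
    (x : Basis (Fin n) F X.L) (x' : Basis (Fin n) F (g • X).L)
    (hx' : ∀ i, (x' i : V) = g.1 (x i)) :
    (intertwinerVia ψ (g • N) (g • M) (g • X) x').toLinearMap =
      (modelTransport ψ g N).toLinearMap ∘ₗ (intertwinerVia ψ N M X x).toLinearMap ∘ₗ
        (modelTransport ψ g M).symm.toLinearMap := by
  rw [intertwinerVia, intertwinerVia]
  simp only [hx', pairing_sp_smul]
  rw [Representation.IntertwiningMap.toLinearMap_smul,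
    Representation.IntertwiningMap.toLinearMap_smul,
    Representation.IntertwiningMap.comp_toLinearMap,
    Representation.IntertwiningMap.comp_toLinearMap, averaging_sp_smul, averaging_sp_smul,
    LinearMap.smul_comp, LinearMap.comp_smul]
  congr 1
  ext1 f
  simp only [LinearMap.comp_apply, LinearEquiv.coe_coe, LinearEquiv.symm_apply_apply]

variable [FiniteDimensional F V]

/-- Here both ends are `M`, so the form is `0` and its Gauss sum is `qⁿ`. -/
theorem averaging_comp_averaging (hF : ringChar F ≠ 2) (hω : ω.IsAlt)
    (hω' : ω.Nondegenerate) (hV : finrank F V = 2 * n) (hψ : ψ ≠ 1)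
    {X M : EnhancedLagrangian ω n} (hXM : Disjoint X.L M.L) :
    (averaging ψ M X).comp (averaging ψ X M) =
      ((Fintype.card F : ℂ) ^ n) • .id (modelRep ψ M) := by
  let x := Module.finBasisOfFinrankEq F X.L (X.isLagrangian.finrank_eq hω' hV)
  obtain ⟨e, he⟩ := exists_dual_basis hω' hV X.isLagrangian M.isLagrangian hXM x
  refine intertwiner_ext hω hω' (Ring.two_ne_zero hF) hψ ?_
  have h0 : formMatrix ω (fun i => (e i : V)) (fun j => e j) = 0 :=
    Matrix.ext fun i j => M.isLagrangian.apply_eq_zero (e i).2 (e j).2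
  rw [Representation.IntertwiningMap.comp_apply, averaging_averaging_modelDelta hXM he he, h0,
    quadGauss_zero, Representation.IntertwiningMap.smul_apply,
    Representation.IntertwiningMap.id_apply]
  change _ = _ * (modelDelta ψ M).1 1
  rw [modelDelta_one, mul_one, Fintype.card_fin]

theorem intertwinerVia_self (hF : ringChar F ≠ 2) (hω : ω.IsAlt)
    (hω' : ω.Nondegenerate) (hV : finrank F V = 2 * n) (hψ : ψ ≠ 1)
    {X M : EnhancedLagrangian ω n} (hXM : Disjoint X.L M.L)
    (x : Basis (Fin n) F X.L) : intertwinerVia ψ M M X x = .id (modelRep ψ M) := by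
  have hq : ((Fintype.card F : ℂ) ^ n) ≠ 0 := pow_ne_zero _ (by simp [Fintype.card_ne_zero])
  rw [intertwinerVia, averaging_comp_averaging hF hω hω' hV hψ hXM,
    legendre_mul_self (pairing_ne_zero hω' hV X.isLagrangian hXM x), mul_one, smul_smul,
    inv_mul_cancel₀ hq, one_smul]

/-- The two inner averagings cancel up to `qⁿ`, and the sign of `M` occurs twice. Only
transversality of `X` to the middle Lagrangian matters. -/
theorem intertwinerVia_comp (hF : ringChar F ≠ 2) (hω : ω.IsAlt)
    (hω' : ω.Nondegenerate) (hV : finrank F V = 2 * n) (hψ : ψ ≠ 1)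
    {X N M L : EnhancedLagrangian ω n} (hXM : Disjoint X.L M.L)
    (x : Basis (Fin n) F X.L) :
    (intertwinerVia ψ N M X x).comp (intertwinerVia ψ M L X x) = intertwinerVia ψ N L X x := by
  have hq : ((Fintype.card F : ℂ) ^ n) ≠ 0 := pow_ne_zero _ (by simp [Fintype.card_ne_zero])
  have hM := legendre_mul_self (pairing_ne_zero hω' hV X.isLagrangian hXM x)
  have h := averaging_comp_averaging hF hω hω' hV hψ hXM.symm
  have hcomp : ((averaging ψ N X).comp (averaging ψ X M)).comp
      ((averaging ψ M X).comp (averaging ψ X L)) =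
        ((Fintype.card F : ℂ) ^ n) • (averaging ψ N X).comp (averaging ψ X L) := by
    calc
      _ = (averaging ψ N X).comp
          (((averaging ψ X M).comp (averaging ψ M X)).comp (averaging ψ X L)) := rfl
      _ = _ := by
        rw [h, Representation.IntertwiningMap.smul_comp, Representation.IntertwiningMap.comp_smul]
        rfl
  rw [intertwinerVia, intertwinerVia, intertwinerVia, Representation.IntertwiningMap.smul_comp,
    Representation.IntertwiningMap.comp_smul, hcomp, smul_smul, smul_smul]
  congr 1
  field_simp
  linear_combination (legendre (pairing (fun i => (x i : V)) N) *
    legendre (pairing (fun i => (x i : V)) L)) * hM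

theorem intertwinerVia_eq (hF : ringChar F ≠ 2) (hω : ω.IsAlt)
    (hω' : ω.Nondegenerate) (hV : finrank F V = 2 * n) (hψ : ψ ≠ 1)
    {X Y N M : EnhancedLagrangian ω n} (hXN : Disjoint X.L N.L)
    (hXM : Disjoint X.L M.L) (hYN : Disjoint Y.L N.L) (hYM : Disjoint Y.L M.L)
    (x : Basis (Fin n) F X.L) (y : Basis (Fin n) F Y.L) :
    intertwinerVia ψ N M X x = intertwinerVia ψ N M Y y := by
  obtain ⟨e, he⟩ := exists_dual_basis hω' hV X.isLagrangian M.isLagrangian hXM x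
  obtain ⟨f, hf⟩ := exists_dual_basis hω' hV X.isLagrangian N.isLagrangian hXN x
  obtain ⟨e', he'⟩ := exists_dual_basis hω' hV Y.isLagrangian M.isLagrangian hYM y
  obtain ⟨f', hf'⟩ := exists_dual_basis hω' hV Y.isLagrangian N.isLagrangian hYN y
  refine intertwiner_ext hω hω' (Ring.two_ne_zero hF) hψ ?_
  change _ * (averaging ψ N X (averaging ψ X M (modelDelta ψ M))).1 1 =
    _ * (averaging ψ N Y (averaging ψ Y M (modelDelta ψ M))).1 1
  rw [averaging_averaging_modelDelta hXM he hf, averaging_averaging_modelDelta hYM he' hf',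
    mul_assoc (_)⁻¹, legendre_mul_quadGauss_eq hF hψ hω X.isLagrangian Y.isLagrangian hXM
      he hf he' hf', ← mul_assoc (_)⁻¹]

/-- The canonical intertwining operators, computed by any transversal Lagrangian. -/
theorem exists_canonical_intertwiner (hF : ringChar F ≠ 2) (hω : ω.IsAlt)
    (hω' : ω.Nondegenerate) (hV : finrank F V = 2 * n) (hψ : ψ ≠ 1) :
    ∃ I : (M L : EnhancedLagrangian ω n) → Intertwiners ψ M L,
      ∀ (M L X : EnhancedLagrangian ω n) (x : Basis (Fin n) F X.L), Disjoint X.L M.L →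
        Disjoint X.L L.L → I M L = intertwinerVia ψ M L X x := by
  choose X hXM hXL _ using fun M L : EnhancedLagrangian ω n =>
    exists_transversal (Ring.two_ne_zero hF) hω hω' hV M L L
  exact ⟨fun M L => intertwinerVia ψ M L (X M L)
    (Module.finBasisOfFinrankEq F _ ((X M L).isLagrangian.finrank_eq hω' hV)),
    fun M L Y y hYM hYL =>
      intertwinerVia_eq hF hω hω' hV hψ (hXM M L) (hXL M L) hYM hYL _ y⟩

end Canonical

/-- The four conditions on a system of canonical intertwining operators. -/
structure IsCanonicalSystem {F : Type*} [Field F] [Fintype F] [DecidableEq F] {V : Type*}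
    [AddCommGroup V] [Module F V] {ω : LinearMap.BilinForm F V} {n : ℕ} {ψ : AddChar F ℂ}
    (I : (M L : EnhancedLagrangian ω n) → Intertwiners ψ M L) : Prop where
  self : ∀ L, I L L = .id (modelRep ψ L)
  equivariant : ∀ (g : Sp ω) (M L : EnhancedLagrangian ω n),
    (I (g • M) (g • L)).toLinearMap =
      (modelTransport ψ g M).toLinearMap ∘ₗ (I M L).toLinearMap ∘ₗ
        (modelTransport ψ g L).symm.toLinearMap
  comp : ∀ N M L : EnhancedLagrangian ω n, (I N M).comp (I M L) = I N L
  sign : ∀ (a : Fˣ) (M L : EnhancedLagrangian ω n),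
    I (a • M) L = ((quadraticChar F a : ℤ) : ℂ) • I M L ∧
    I M (a • L) = ((quadraticChar F a : ℤ) : ℂ) • I M L

/-! ### Existence and uniqueness of the canonical system. -/

section Main

variable {F : Type*} [Field F] [Fintype F] [DecidableEq F] {V : Type*} [AddCommGroup V]
  [Module F V] [FiniteDimensional F V] {ω : LinearMap.BilinForm F V} {n : ℕ} {ψ : AddChar F ℂ}

theorem exists_isCanonicalSystem (hF : ringChar F ≠ 2) (hω : ω.IsAlt) (hω' : ω.Nondegenerate)
    (hV : finrank F V = 2 * n) (hψ : ψ ≠ 1) :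
    ∃ I : (M L : EnhancedLagrangian ω n) → Intertwiners ψ M L, IsCanonicalSystem I := by
  have : Finite V := Module.finite_of_finite F
  have (L : Submodule F V) : Fintype L := Fintype.ofFinite L
  obtain ⟨I, hI⟩ := exists_canonical_intertwiner hF hω hω' hV hψ
  have basis (X : EnhancedLagrangian ω n) : Basis (Fin n) F X.L :=
    Module.finBasisOfFinrankEq F _ (X.isLagrangian.finrank_eq hω' hV)
  have htrans := exists_transversal (Ring.two_ne_zero hF) hω hω' hV
  refine ⟨I, ⟨fun L => ?_, fun g M L => ?_, fun N M L => ?_, fun a M L => ?_⟩⟩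
  · obtain ⟨X, hX, -, -⟩ := htrans L L L
    rw [hI L L X (basis X) hX hX, intertwinerVia_self hF hω hω' hV hψ hX]
  · obtain ⟨X, hXM, hXL, -⟩ := htrans M L L
    rw [hI M L X (basis X) hXM hXL, hI (g • M) (g • L) (g • X)
      ((basis X).map (g.1.submoduleMap X.L)) (Submodule.disjoint_map g.1.injective hXM)
      (Submodule.disjoint_map g.1.injective hXL)]
    exact intertwinerVia_sp_smul g M L X (basis X) _ fun i => rfl
  · obtain ⟨X, hXN, hXM, hXL⟩ := htrans N M L
    rw [hI N M X (basis X) hXN hXM, hI M L X (basis X) hXM hXL, hI N L X (basis X) hXN hXL,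
      intertwinerVia_comp hF hω hω' hV hψ hXM]
  · obtain ⟨X, hXM, hXL, -⟩ := htrans M L L
    rw [hI M L X (basis X) hXM hXL]
    exact ⟨(hI (a • M) L X (basis X) hXM hXL).trans (intertwinerVia_smul_left ..),
      (hI M (a • L) X (basis X) hXM hXL).trans (intertwinerVia_smul_right ..)⟩

/-- Each `I N M` is nonzero, because `I M N` composed with it is the identity; so `J = c • I` for
scalars `c`. The two sign rules cancel in `c`, leaving a cocycle to which `cocycle_eq_one` applies.
-/
theorem IsCanonicalSystem.unique (hF : ringChar F ≠ 2) (hω : ω.IsAlt) (hω' : ω.Nondegenerate)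
    (hV : finrank F V = 2 * n) (hψ : ψ ≠ 1)
    {I J : (M L : EnhancedLagrangian ω n) → Intertwiners ψ M L} (hI : IsCanonicalSystem I)
    (hJ : IsCanonicalSystem J) : J = I := by
  have h2 : (2 : F) ≠ 0 := Ring.two_ne_zero hF
  have hid (M : EnhancedLagrangian ω n) : (.id (modelRep ψ M) : Intertwiners ψ M M) ≠ 0 := by
    intro h
    have := congrArg (fun Φ : Intertwiners ψ M M => (Φ (modelDelta ψ M)).1 1) h
    exact one_ne_zero ((modelDelta_one M).symm.trans this)
  have hI0 (N M : EnhancedLagrangian ω n) : I N M ≠ 0 := by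
    intro h
    refine hid M ?_
    rw [← hI.self, ← hI.comp M N M, h]
    ext1
    rw [Representation.IntertwiningMap.comp_toLinearMap]
    exact LinearMap.comp_zero _
  have hval (N M : EnhancedLagrangian ω n) : (I N M (modelDelta ψ M)).1 1 ≠ 0 := fun h =>
    hI0 N M (intertwiner_ext hω hω' h2 hψ h)
  have hsmul (N M : EnhancedLagrangian ω n) : ∃ c : ℂ, J N M = c • I N M := by
    refine ⟨(J N M (modelDelta ψ M)).1 1 / (I N M (modelDelta ψ M)).1 1, ?_⟩
    refine intertwiner_ext hω hω' h2 hψ ?_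
    exact (div_mul_cancel₀ _ (hval N M)).symm
  have hcancel {N M : EnhancedLagrangian ω n} {c d : ℂ} (h : c • I N M = d • I N M) : c = d := by
    have := congrArg (fun Φ : Intertwiners ψ N M => (Φ (modelDelta ψ M)).1 1) h
    exact mul_right_cancel₀ (hval N M) this
  choose c hc using hsmul
  have hone := cocycle_eq_one h2 hω hω' hV (c := c) (fun M => ?_) (fun N M L => ?_)
    (fun g N M => ?_) (fun a N M => ?_) (fun a N M => ?_)
  · funext N M
    rw [hc, hone, one_smul]
  · refine hcancel (N := M) (M := M) ?_
    rw [← hc, hJ.self, hI.self, one_smul]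
  · refine hcancel (N := N) (M := L) ?_
    rw [← hc, ← hJ.comp N M L, hc N M, hc M L, Representation.IntertwiningMap.smul_comp,
      Representation.IntertwiningMap.comp_smul, hI.comp, smul_smul]
  · refine hcancel (N := g • N) (M := g • M) ?_
    ext1
    rw [← hc, hJ.equivariant, hc, Representation.IntertwiningMap.toLinearMap_smul,
      Representation.IntertwiningMap.toLinearMap_smul, hI.equivariant]
    ext1 f
    simp
  · have ha : legendre (a : F) ≠ 0 := legendre_ne_zero a.ne_zero
    have e1 := (hJ.sign a N M).1
    rw [hc (a • N) M, (hI.sign a N M).1, hc N M] at e1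
    have e2 := hcancel (N := N) (M := M)
      (c := c (a • N) M * legendre (a : F)) (d := legendre (a : F) * c N M)
      (by rw [mul_smul, mul_smul]; exact e1)
    exact mul_left_cancel₀ ha (by rw [← e2, mul_comm])
  · have ha : legendre (a : F) ≠ 0 := legendre_ne_zero a.ne_zero
    have e1 := (hJ.sign a N M).2
    rw [hc N (a • M), (hI.sign a N M).2, hc N M] at e1
    have e2 := hcancel (N := N) (M := M)
      (c := c N (a • M) * legendre (a : F)) (d := legendre (a : F) * c N M)
      (by rw [mul_smul, mul_smul]; exact e1)
    exact mul_left_cancel₀ ha (by rw [← e2, mul_comm])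

end Main

end FiniteHeisenberg

theorem mainTheorem6 {F : Type*} [Field F] [Fintype F] [DecidableEq F] (hF : ringChar F ≠ 2)
    {V : Type*} [AddCommGroup V] [Module F V] [FiniteDimensional F V]
    (n : ℕ) (hV : Module.finrank F V = 2 * n)
    (ω : LinearMap.BilinForm F V) (hω : ω.IsAlt) (hω' : ω.Nondegenerate)
    (ψ : AddChar F ℂ) (hψ : ψ ≠ 1) :
    ∃! I : (M L : EnhancedLagrangian ω n) → Intertwiners ψ M L,
      (∀ L, I L L = .id (modelRep ψ L)) ∧
      (∀ (g : Sp ω) (M L : EnhancedLagrangian ω n),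
        (I (g • M) (g • L)).toLinearMap =
          (modelTransport ψ g M).toLinearMap ∘ₗ (I M L).toLinearMap ∘ₗ
            (modelTransport ψ g L).symm.toLinearMap) ∧
      (∀ N M L : EnhancedLagrangian ω n, (I N M).comp (I M L) = I N L) ∧
      (∀ (a : Fˣ) (M L : EnhancedLagrangian ω n),
        I (a • M) L = ((quadraticChar F a : ℤ) : ℂ) • I M L ∧
        I M (a • L) = ((quadraticChar F a : ℤ) : ℂ) • I M L) := by
  obtain ⟨I, hI⟩ := exists_isCanonicalSystem hF hω hω' hV hψ
  exact ⟨I, ⟨hI.self, hI.equivariant, hI.comp, hI.sign⟩, fun J ⟨h1, h2, h3, h4⟩ =>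
    hI.unique hF hω hω' hV hψ ⟨h1, h2, h3, h4⟩⟩
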